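/- **Model.** There are $n\ge 1$ machines, and a leader chosen uniformly at random among them and known to all. Machine $u$ holds an input $x_u\in\mathbb R^d$ ($d\ge1$) and has private randomness. The leader, the inputs and the private random seeds are independent. Computation proceeds in synchronous rounds of fault-free message passing: any machine may send a (possibly empty) bit string to any machine. All machines act in the first round, and afterwards a machine acts whenever it has just received at least one bit. What it sends, and what it outputs in the end (when no message is under way), depends only on the leader, its own identity, its input, its seed, and the string of bits it has received so far. The cost of a machine is the total number of bits it sends and receives. **Problem (VarianceReduction).** For an unknown $\nabla\in\mathbb R^d$ the inputs $x_u$ are independent with $\mathbb E[x_u]=\nabla$ and $\mathbb E\|x_u-\nabla\|^2\le\sigma^2$, where $\sigma\ge0$ is known and $\|\cdot\|$ is the $\ell_1$, $\ell_2$ or $\ell_\infty$ norm. **Theorem.** For every constant $q_0>1$ and every integer $k\ge0$ there is a constant $C>0$ such that for each of these three norms, all $d,n\ge1$, all $\sigma\ge0$ and all real $q\ge q_0$ there are a protocol and a measurable function $z$ of (leader, inputs, seeds) with values in $\mathbb R^d$, neither depending on $\nabla$ or on the distribution of the inputs, with the following properties for every $\nabla$ and all input distributions as above. 1. Every machine sends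 and receives, in expectation over leader, inputs and seeds, at most $C(d\log q+\log n)$ bits. 2. $z$ is an unbiased estimator of $\nabla$, that is, $\mathbb E[z]=\nabla$. 3. $\mathbb E\|z-\nabla\|^2\le C\left(\frac{\sigma^2}{q}+\mathbb E\left\|\frac1n\sum_u x_u-\nabla\right\|^2\right)$, and for the $\ell_2$ norm $\mathbb E\|z-\nabla\|^2\le C\left(\frac{\sigma^2}{q}+\frac{\sigma^2}{n}\right)$. 4. With probability at least $1-n^{-k}$ the execution comes to an end and all machines output the same value $z$. -/

import Mathlib

open MeasureTheory ProbabilityTheory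
open scoped ENNReal

/-- A randomized message-passing protocol for `n` machines, each of which holds an input in `E`,
has its own private source of randomness, and knows the identity of a common leader.

All that a machine can act on is the leader's identity, its own identity, its own input, its own
seed and the string of bits that it has received so far: there is no clock, and no information is
conveyed by the time at which a message is sent. -/
structure Protocol (n : ℕ) (E : Type) [MeasurableSpace E] where
  /-- the values of a machine's private randomness -/
  Seed : Type
  /-- the measurable structure of the seeds -/
  seedSpace : MeasurableSpace Seed
  /-- the distribution of a machine's private seed -/
  law : Measure Seed
  /-- the distribution of a seed is a probability distribution -/
  isProb : IsProbabilityMeasure law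
  /-- `send l u x s B w` is the message (possibly empty) that machine `u` with input `x` and seed
  `s` sends to machine `w`, when `l` is the leader and `B` is the string of bits received by `u`
  up to now -/
  send : Fin n → Fin n → E → Seed → List Bool → Fin n → List Bool
  /-- `output l u x s B` is the value that machine `u` with input `x` and seed `s` outputs, when `l`
  is the leader and `B` is the whole string of bits that `u` has received -/
  output : Fin n → Fin n → E → Seed → List Bool → E
  /-- messages are measurable functions of the input and the seed -/
  measurableSet_send : ∀ l u B w m, MeasurableSet {a : E × Seed | send l u a.1 a.2 B w = m}
  /-- outputs are measurable functions of the input and the seed -/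
  measurable_output : ∀ l u B, Measurable fun a : E × Seed => output l u a.1 a.2 B

attribute [instance] Protocol.seedSpace Protocol.isProb

/-- A global configuration of a network of `n` machines: the string of bits that each machine has
received so far, and whether it is due to act in the coming round. -/
structure Config (n : ℕ) where
  /-- the string of all bits received so far -/
  received : Fin n → List Bool
  /-- whether the machine acts in the coming round -/
  active : Fin n → Bool

namespace Protocol

variable {n : ℕ} {E : Type} [MeasurableSpace E]

/-- All that an execution depends on: the leader, the inputs of the machines and their seeds. -/
abbrev Outcome (P : Protocol n E) : Type := Fin n × (Fin n → E) × (Fin n → P.Seed)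

/-- The message from `u` to `w` in a round that starts in configuration `c`. -/
def outbox (P : Protocol n E) (o : P.Outcome) (c : Config n) (u w : Fin n) : List Bool :=
  if c.active u then P.send o.1 u (o.2.1 u) (o.2.2 u) (c.received u) w else []

/-- The bits that `w` receives in a round that starts in configuration `c`: the messages to `w`,
one after the other. -/
def inbox (P : Protocol n E) (o : P.Outcome) (c : Config n) (w : Fin n) : List Bool :=
  (List.finRange n).flatMap fun u => P.outbox o c u w

/-- One synchronous round: the active machines send their messages, and the machines that receive
at least one bit are the active ones of the next round. -/
def step (P : Protocol n E) (o : P.Outcome) (c : Config n) : Config n where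
  received w := c.received w ++ P.inbox o c w
  active w := !(P.inbox o c w).isEmpty

/-- The configuration after `t` rounds; at the start nothing has been received and every machine
is active. -/
def run (P : Protocol n E) (o : P.Outcome) (t : ℕ) : Config n :=
  (P.step o)^[t] ⟨fun _ => [], fun _ => true⟩

/-- The total number of bits that machine `u` sends and receives (possibly infinite). -/
noncomputable def bits (P : Protocol n E) (o : P.Outcome) (u : Fin n) : ℝ≥0∞ :=
  ∑' t : ℕ, (((P.inbox o (P.run o t) u).length + ∑ w, (P.outbox o (P.run o t) u w).length : ℕ) :
    ℝ≥0∞)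

/-- The execution comes to an end (no message is under way), and every machine outputs `y`. -/
def AllOutput (P : Protocol n E) (o : P.Outcome) (y : E) : Prop :=
  ∃ t : ℕ, (∀ u, (P.run o t).active u = false) ∧
    ∀ u, P.output o.1 u (o.2.1 u) (o.2.2 u) ((P.run o t).received u) = y

/-- The probability distribution of the outcomes, when the leader is chosen uniformly at random,
machine `u` has an input of distribution `ν u`, and the leader, the inputs and the seeds are
independent. -/
noncomputable def prob (P : Protocol n E) (ν : Fin n → Measure E) : Measure P.Outcome :=
  (uniformOn (Set.univ : Set (Fin n))).prod ((Measure.pi ν).prod (Measure.pi fun _ => P.law))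

end Protocol

/-- The random vector `Z` is integrable with mean `g`. -/
def IsUnbiased {Ω E : Type} [MeasurableSpace Ω] [NormedAddCommGroup E] [NormedSpace ℝ E]
    (μ : Measure Ω) (Z : Ω → E) (g : E) : Prop :=
  Integrable Z μ ∧ ∫ ω, Z ω ∂μ = g

/-- The mean squared distance of the random vector `Z` from `g`; the variance of `Z` if `g` is the
mean of `Z`. -/
noncomputable def meanSqDist {Ω E : Type} [MeasurableSpace Ω] [NormedAddCommGroup E]
    (μ : Measure Ω) (Z : Ω → E) (g : E) : ℝ≥0∞ :=
  ∫⁻ ω, ‖Z ω - g‖ₑ ^ 2 ∂μ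

/-! Every machine rounds its input without bias to the lattice `δ ℤ^d`, where `δ = σ / (s * c)`, `s
= ⌈√q⌉₊` and `c` is the norm of the all-ones vector. The leader collects the integer vectors, rounds
their average without bias to an integer vector and returns it. Each of the two roundings moves a
coordinate by at most `δ`, so the estimate is within `2σ/s` of the empirical mean
(`meanSqDist_meanEstimate_le`). The estimate is a function of leader, inputs and seeds alone,
defined whether or not the execution delivers it, so it is exactly unbiased
(`isUnbiased_meanEstimate`).

Inputs are unbounded, so only differences may be transmitted. Two quantized inputs differ in `ℓ₁`
norm by `O(s * d)` in expectation. A machine does not know the leader's vector; it answers with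
blocks, each containing a fresh random point of a prime field and the value there of the polynomial
with its vector as coefficients. After `j` blocks the leader searches the vectors within distance `s
* b * j` of its own, where `b` is of order `d log q + log n`. There are at most about `2^(5bj)` of
them, and a wrong one survives `j` blocks with probability at most `(d / prime)^j`; a prime with
`O(b)` bits makes the union bound a small geometric series (`measureReal_collision_le`). The true
vector is found after at most `1 + distance / (s * b)` blocks (`exists_decoded`), which is `O(1)` in
expectation. In the other direction the leader sends the difference between the average and the
machine's vector, in a code of length `b + O(distance / s)` (`length_vecCode_le`). The length bounds
hold even if a decoding is wrong. Failure means a hash collision or a wraparound modulo the prime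
(`measureReal_failure_le`).

The leader takes part in all conversations, but a machine is the leader only with probability `1/n`,
so its expected cost remains `O(b)` (`lintegral_cost_le`). Questions of one bit each replace a
clock: a machine counts them to know which bit of its answer is due. If `σ = 0`, all inputs agree
almost surely and nothing need be sent. -/

/-! ### A code for integer vectors -/

/-- A self-delimiting code for bit strings. -/
def selfDelim : List Bool → List Bool
  | [] => [false]
  | b :: l => true :: b :: selfDelim l

theorem selfDelim_append_inj {l l' r r' : List Bool}
    (h : selfDelim l ++ r = selfDelim l' ++ r') : l = l' ∧ r = r' := by
  induction l generalizing l' with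
  | nil => cases l' <;> simp_all [selfDelim]
  | cons b l ih =>
    cases l' with
    | nil => simp [selfDelim] at h
    | cons b' l' =>
      simp only [selfDelim, List.cons_append, List.cons.injEq, true_and] at h
      obtain ⟨rfl, h⟩ := h
      obtain ⟨rfl, rfl⟩ := ih h
      exact ⟨rfl, rfl⟩

theorem length_selfDelim (l : List Bool) : (selfDelim l).length = 2 * l.length + 1 := by
  induction l with
  | nil => rfl
  | cons b l ih => simp [selfDelim, ih]; ring

theorem Nat.bits_injective' : Function.Injective Nat.bits := by
  intro m n h
  have := congrArg (List.map fun b : Bool => cond b 1 0) h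
  rw [← Nat.digits_two_eq_bits, ← Nat.digits_two_eq_bits] at this
  exact Nat.digits_inj_iff.1 this

/-- A self-delimiting code for integers. -/
def intCode (a : ℤ) : List Bool := selfDelim (Nat.bits (Equiv.intEquivNat a))

theorem intCode_append_inj {a a' : ℤ} {r r' : List Bool} (h : intCode a ++ r = intCode a' ++ r') :
    a = a' ∧ r = r' := by
  obtain ⟨h₁, h₂⟩ := selfDelim_append_inj h
  exact ⟨Equiv.intEquivNat.injective (Nat.bits_injective' h₁), h₂⟩

/-- An injective code for integer vectors. -/
def vecCode {d : ℕ} (w : Fin d → ℤ) : List Bool := (List.finRange d).flatMap fun i => intCode (w i)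

theorem vecCode_injective (d : ℕ) : Function.Injective (vecCode (d := d)) := by
  have key : ∀ (l : List (Fin d)) (w w' : Fin d → ℤ),
      (l.flatMap fun i => intCode (w i)) = (l.flatMap fun i => intCode (w' i)) →
      ∀ i ∈ l, w i = w' i := by
    intro l w w'
    induction l with
    | nil => simp
    | cons i l ih =>
      intro h
      simp only [List.flatMap_cons] at h
      obtain ⟨h₁, h₂⟩ := intCode_append_inj h
      simpa [h₁] using ih h₂
  intro w w' h
  ext i
  exact key _ w w' h i (List.mem_finRange i)

theorem intEquivNat_le (a : ℤ) : Equiv.intEquivNat a ≤ 2 * a.natAbs := by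
  cases a with
  | ofNat n =>
    change Nat.bit false n ≤ 2 * n
    simp [Nat.bit]
  | negSucc n =>
    change Nat.bit true n ≤ 2 * (n + 1)
    simp only [Nat.bit, cond_true]
    omega

/-- The excess over `s.size` is bounded linearly, not logarithmically, in `m / s`: such bounds add
up over the coordinates to an `ℓ₁` norm, and their expectations need only first moments. -/
theorem Nat.size_le_size_add_div {s : ℕ} (hs : 0 < s) (m : ℕ) : m.size ≤ s.size + m / s := by
  rw [Nat.size_le]
  calc m < s * (m / s + 1) := by
        rw [mul_add, mul_one]; exact Nat.lt_mul_div_succ m hs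
    _ ≤ 2 ^ s.size * 2 ^ (m / s) :=
        Nat.mul_le_mul (Nat.lt_size_self s).le Nat.lt_two_pow_self
    _ = _ := by rw [pow_add]

/-- The `ℓ₁` norm of an integer vector. -/
def sumAbs {d : ℕ} (w : Fin d → ℤ) : ℕ := ∑ i, (w i).natAbs

theorem sumAbs_sub_le {d : ℕ} (v w : Fin d → ℤ) : sumAbs (v - w) ≤ sumAbs v + sumAbs w := by
  unfold sumAbs
  rw [← Finset.sum_add_distrib]
  exact Finset.sum_le_sum fun i _ => Int.natAbs_sub_le _ _

/-- The first summand pays for entries of size about `s`, the second for larger ones. The factor 4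
arises because `intEquivNat` and `selfDelim` double values and lengths, respectively. -/
theorem length_vecCode_le {d s : ℕ} (hs : 0 < s) (w : Fin d → ℤ) :
    (vecCode w).length ≤ d * (2 * s.size + 1) + 4 * sumAbs w / s := by
  have h1 : (vecCode w).length = ∑ i, (2 * (Equiv.intEquivNat (w i)).size + 1) := by
    rw [vecCode, List.length_flatMap, ← List.ofFn_eq_map, List.sum_ofFn]
    simp [intCode, length_selfDelim, Nat.size_eq_bits_len]
  have h2 : ∀ i, 2 * (Equiv.intEquivNat (w i)).size + 1 ≤
      (2 * s.size + 1) + 4 * (w i).natAbs / s := by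
    intro i
    have h3 := Nat.size_le_size_add_div hs (Equiv.intEquivNat (w i))
    have h4 : 2 * (Equiv.intEquivNat (w i) / s) ≤ 4 * (w i).natAbs / s := by
      rw [Nat.le_div_iff_mul_le hs]
      have := intEquivNat_le (w i)
      have := Nat.div_mul_le_self (Equiv.intEquivNat (w i)) s
      rw [mul_assoc]; omega
    omega
  rw [h1]
  refine (Finset.sum_le_sum fun i _ => h2 i).trans ?_
  rw [Finset.sum_add_distrib]
  simp only [Finset.sum_const, Finset.card_univ, Fintype.card_fin, smul_eq_mul]
  gcongr
  rw [Nat.le_div_iff_mul_le hs, Finset.sum_mul, sumAbs, Finset.mul_sum]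
  exact Finset.sum_le_sum fun i _ => Nat.div_mul_le_self _ _

/-- Serves to count the lattice points of an `ℓ₁` ball by the lengths of their codes. -/
theorem card_le_of_length_le {β : Type*} (f : β → List Bool) (hf : Function.Injective f) (N : ℕ)
    (S : Finset β) (hS : ∀ x ∈ S, (f x).length ≤ N) : S.card ≤ 2 ^ (N + 1) := by
  classical
  let T : Finset (Σ m : Fin (N + 1), List.Vector Bool m) := Finset.univ
  have hT : T.card ≤ 2 ^ (N + 1) := by
    simp only [T, Finset.card_univ, Fintype.card_sigma, card_vector, Fintype.card_bool]
    rw [Fin.sum_univ_eq_sum_range fun m => 2 ^ m, Nat.geomSum_eq le_rfl]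
    simp
  refine le_trans ?_ hT
  refine Finset.card_le_card_of_injOn
    (fun x => if h : (f x).length ≤ N then ⟨⟨(f x).length, by omega⟩, ⟨f x, rfl⟩⟩
      else ⟨0, List.Vector.nil⟩) (fun _ _ => Finset.mem_univ _) ?_
  intro x hx y hy hxy
  simp only [hS x hx, hS y hy, dite_true] at hxy
  have : ∀ p q : (Σ m : Fin (N + 1), List.Vector Bool m), p = q → p.2.toList = q.2.toList := by
    rintro p _ rfl; rfl
  exact hf (this _ _ hxy)

/-! ### Polynomial hashing -/

/-- The value at `a` of the polynomial with the coefficients `w`. -/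
def polyHash {d : ℕ} {F : Type*} [Field F] (a : F) (w : Fin d → F) : F :=
  ∑ i : Fin d, w i * a ^ (i : ℕ)

theorem polyHash_sub {d : ℕ} {F : Type*} [Field F] (a : F) (v w : Fin d → F) :
    polyHash a (v - w) = polyHash a v - polyHash a w := by
  simp [polyHash, sub_mul]

theorem card_polyHash_eq_zero_le {d : ℕ} {F : Type*} [Field F] [Fintype F] [DecidableEq F]
    {w : Fin d → F} (hw : w ≠ 0) : (Finset.univ.filter fun a : F => polyHash a w = 0).card ≤ d := by
  classical
  let p : Polynomial F := ∑ i : Fin d, Polynomial.monomial (i : ℕ) (w i)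
  have hcoeff : ∀ i : Fin d, p.coeff i = w i := by
    intro i
    simp [p, Polynomial.finsetSum_coeff, Polynomial.coeff_monomial, Fin.val_inj]
  have hp : p ≠ 0 := by
    rintro h
    refine hw (funext fun i => ?_)
    rw [← hcoeff i, h]; simp
  have hdeg : p.natDegree ≤ d :=
    Polynomial.natDegree_sum_le_of_forall_le _ _ fun i _ =>
      (Polynomial.natDegree_monomial_le _).trans i.2.le
  have heval : ∀ a, p.eval a = polyHash a w := fun a => by
    simp [p, polyHash, Polynomial.eval_finsetSum, Polynomial.eval_monomial]
  calc _ ≤ p.roots.toFinset.card := by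
        refine Finset.card_le_card fun a ha => ?_
        simp only [Finset.mem_filter, Finset.mem_univ, true_and] at ha
        simp [hp, heval, ha]
    _ ≤ p.roots.card := Multiset.toFinset_card_le _
    _ ≤ p.natDegree := Polynomial.card_roots' _
    _ ≤ d := hdeg

/-! ### Interrogations -/

/-- The rules of an interrogation: the leader asks the other machines, one after the other, for
bits of their answers, until it has decoded each answer; then it sends a closing message to each of
them. A machine acts on its local data only. -/
structure Interrogation (n : ℕ) (E Data G : Type) where
  /-- the bits that a machine answers with -/
  ans : Data → ℕ → Bool
  /-- what the leader reads off from the first few bits of an answer, if they suffice -/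
  dec : Data → List Bool → Option G
  /-- the closing messages of the leader -/
  closing : Data → (Fin n → G) → Fin n → List Bool
  /-- the output of a machine that receives the given closing message -/
  out : Data → List Bool → E
  /-- the output of the leader -/
  leaderOut : Data → (Fin n → G) → E

namespace Interrogation

variable {n : ℕ} {E Data G : Type} [Inhabited G]

/-- The leader's bookkeeping when one more bit arrives: the machines whose answers are not yet
decoded, the bits of the current answer, and the decoded answers. -/
def advance (I : Interrogation n E Data G) (D : Data) :
    List (Fin n) × List Bool × (Fin n → G) → Bool → List (Fin n) × List Bool × (Fin n → G)
  | ([], cur, r), _ => ([], cur, r)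
  | (u :: us, cur, r), b =>
    match I.dec D (cur ++ [b]) with
    | none => (u :: us, cur ++ [b], r)
    | some w => (us, [], Function.update r u w)

/-- The leader's bookkeeping after it has received the bits `B`. -/
def state (I : Interrogation n E Data G) (l : Fin n) (D : Data) (B : List Bool) :
    List (Fin n) × List Bool × (Fin n → G) :=
  B.foldl (I.advance D) ((List.finRange n).filter (· ≠ l), [], fun _ => default)

theorem state_append (I : Interrogation n E Data G) (l : Fin n) (D : Data) (B : List Bool)
    (b : Bool) : I.state l D (B ++ [b]) = I.advance D (I.state l D B) b := by
  simp [state]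

/-- The first `m` bits of a machine's answer. -/
def stream (I : Interrogation n E Data G) (D : Data) (m : ℕ) : List Bool :=
  (List.range m).map (I.ans D)

omit [Inhabited G] in
theorem stream_succ (I : Interrogation n E Data G) (D : Data) (m : ℕ) :
    I.stream D (m + 1) = I.stream D m ++ [I.ans D m] := by
  simp [stream, List.range_succ]

/-- The messages of an interrogation. -/
def send (I : Interrogation n E Data G) (l u : Fin n) (D : Data) (B : List Bool) (w : Fin n) :
    List Bool :=
  if u = l then
    match (I.state l D B).1 with
    | [] => if w = l then [] else false :: I.closing D (I.state l D B).2.2 w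
    | v :: _ => if w = v then [true] else []
  -- Questions are `true`, so the length of a string of `true`s tells which answer bit is due. `B =
  -- []` is the first round, in which every machine acts unasked; a `false` in `B` marks the closing
  -- message, after which the machine keeps silent.
  else if w = l ∧ B ≠ [] ∧ B.all id then [I.ans D (B.length - 1)] else []

/-- The outputs of an interrogation. -/
def output (I : Interrogation n E Data G) (l u : Fin n) (D : Data) (B : List Bool) : E :=
  if u = l then I.leaderOut D (I.state l D B).2.2 else I.out D (B.dropWhile id).tail

/-- The protocol of an interrogation, if the input `x` and the seed `s` provide a machine with the
local data `f (x, s)`. -/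
def toProtocol [MeasurableSpace E] [MeasurableSpace Data] [DiscreteMeasurableSpace Data]
    (I : Interrogation n E Data G) {Seed : Type} [MeasurableSpace Seed] (law : Measure Seed)
    [IsProbabilityMeasure law] (f : E × Seed → Data) (hf : Measurable f) : Protocol n E where
  Seed := Seed
  seedSpace := inferInstance
  law := law
  isProb := inferInstance
  send l u x s B w := I.send l u (f (x, s)) B w
  output l u x s B := I.output l u (f (x, s)) B
  measurableSet_send l u B w m :=
    hf (MeasurableSet.of_discrete (s := {D | I.send l u D B w = m}))
  measurable_output l u B := (Measurable.of_discrete (f := fun D => I.output l u D B)).comp hf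

end Interrogation

theorem List.flatMap_eq_of_forall_ne {α β : Type*} {l : List α} (hl : l.Nodup) {f : α → List β}
    {a : α} (ha : a ∈ l) (h : ∀ b, b ≠ a → f b = []) : l.flatMap f = f a := by
  induction l with
  | nil => simp at ha
  | cons c l ih =>
    rw [List.flatMap_cons]
    by_cases hc : c = a
    · subst hc
      have : l.flatMap f = [] := List.flatMap_eq_nil_iff.2 fun b hb =>
        h b (by rintro rfl; exact (List.nodup_cons.1 hl).1 hb)
      rw [this, List.append_nil]
    · rw [h c hc, List.nil_append]
      exact ih (List.nodup_cons.1 hl).2 ((List.mem_cons.1 ha).resolve_left (Ne.symm hc))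

/-! ### Termination and cost of an execution -/

namespace Protocol

variable {n : ℕ} {E : Type} [MeasurableSpace E]

theorem run_succ (P : Protocol n E) (o : P.Outcome) (t : ℕ) :
    P.run o (t + 1) = P.step o (P.run o t) := by
  simp [run, Function.iterate_succ_apply']

/-- The number of bits that `u` sends and receives in a round that starts in configuration `c`. -/
def roundBits (P : Protocol n E) (o : P.Outcome) (c : Config n) (u : Fin n) : ℕ :=
  (P.inbox o c u).length + ∑ w, (P.outbox o c u w).length

theorem inbox_eq_nil (P : Protocol n E) {o : P.Outcome} {c : Config n} {w : Fin n}
    (h : ∀ u, P.outbox o c u w = []) : P.inbox o c w = [] :=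
  List.flatMap_eq_nil_iff.2 fun u _ => h u

theorem inbox_eq_of_forall_ne (P : Protocol n E) {o : P.Outcome} {c : Config n} {w : Fin n}
    (v : Fin n) (h : ∀ u, u ≠ v → P.outbox o c u w = []) :
    P.inbox o c w = P.outbox o c v w :=
  List.flatMap_eq_of_forall_ne (List.nodup_finRange n) (List.mem_finRange v) h

/-- Without active machines nothing is sent, so the configuration is a fixed point of `step`; this
makes the infinite sum in `bits` finite. -/
theorem run_add_of_inactive (P : Protocol n E) {o : P.Outcome} {t : ℕ}
    (h : ∀ u, (P.run o t).active u = false) (i : ℕ) : P.run o (t + i) = P.run o t := by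
  induction i with
  | zero => rfl
  | succ i ih =>
    rw [← add_assoc, run_succ, ih]
    have hin : ∀ w, P.inbox o (P.run o t) w = [] := fun w =>
      P.inbox_eq_nil fun u => by simp [outbox, h]
    rcases hc : P.run o t with ⟨R, A⟩
    rw [hc] at hin h
    have hA : A = fun _ => false := funext h
    subst hA
    simp [step, hin]

theorem bits_eq_of_inactive (P : Protocol n E) {o : P.Outcome} {t : ℕ}
    (h : ∀ u, (P.run o t).active u = false) (u : Fin n) :
    P.bits o u = ((∑ i ∈ Finset.range t, P.roundBits o (P.run o i) u : ℕ) : ℝ≥0∞) := by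
  rw [Nat.cast_sum]
  refine tsum_eq_sum fun i hi => ?_
  obtain ⟨j, rfl⟩ := Nat.exists_eq_add_of_le (not_lt.1 (fun hlt => hi (Finset.mem_range.2 hlt)))
  rw [run_add_of_inactive P h]
  have hout : ∀ u w, P.outbox o (P.run o t) u w = [] := fun u w => by simp [outbox, h]
  simp [hout, P.inbox_eq_nil fun u => hout u _]

end Protocol

/-! ### The course of an interrogation -/

namespace Interrogation

variable {n : ℕ} {E Data G : Type} [Inhabited G] [MeasurableSpace E] [MeasurableSpace Data]
  [DiscreteMeasurableSpace Data] (I : Interrogation n E Data G) {Seed : Type}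
  [MeasurableSpace Seed] (law : Measure Seed) [IsProbabilityMeasure law] (f : E × Seed → Data)
  (hf : Measurable f)

/-- The local data of the machines. -/
def data (o : (I.toProtocol law f hf).Outcome) (u : Fin n) : Data := f (o.2.1 u, o.2.2 u)

theorem outbox_eq (o : (I.toProtocol law f hf).Outcome) (c : Config n) (u w : Fin n) :
    (I.toProtocol law f hf).outbox o c u w =
    if c.active u then I.send o.1 u (I.data law f hf o u) (c.received u) w else [] := rfl

/-- After `t` rounds it is the leader's turn, it has received the bits `B`, and machine `u` has
answered with `cnt u` bits. -/
structure AtRest (o : (I.toProtocol law f hf).Outcome) (t : ℕ) (B : List Bool) (cnt : Fin n → ℕ) :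
    Prop where
  leader_received : ((I.toProtocol law f hf).run o t).received o.1 = B
  received : ∀ u, u ≠ o.1 →
    ((I.toProtocol law f hf).run o t).received u = List.replicate (cnt u) true
  leader_active : ((I.toProtocol law f hf).run o t).active o.1 = true
  -- Allows for the first round, where machines that have received nothing are active; they send
  -- nothing.
  active : ∀ u, u ≠ o.1 → ((I.toProtocol law f hf).run o t).active u = true → cnt u = 0
  cnt_leader : cnt o.1 = 0
  -- Each answer bit costs one question and one answer, counted both at the machine and at the
  -- leader.
  bits : ∀ u, ∑ i ∈ Finset.range t,
    (I.toProtocol law f hf).roundBits o ((I.toProtocol law f hf).run o i) u =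
      if u = o.1 then 2 * ∑ w, cnt w else 2 * cnt u

variable {I law f hf} {o : (I.toProtocol law f hf).Outcome}


theorem atRest_zero : AtRest I law f hf o 0 [] fun _ => 0 := by
  constructor <;> simp [Protocol.run]

namespace AtRest

variable {t : ℕ} {B : List Bool} {cnt : Fin n → ℕ}

theorem outbox_eq_nil (h : AtRest I law f hf o t B cnt) {u : Fin n} (hu : u ≠ o.1) (w : Fin n) :
    (I.toProtocol law f hf).outbox o ((I.toProtocol law f hf).run o t) u w = [] := by
  rw [outbox_eq]
  split_ifs with ha
  · simp [send, hu, h.received u hu, h.active u hu ha]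
  · rfl

theorem leader_outbox (h : AtRest I law f hf o t B cnt) (w : Fin n) :
    (I.toProtocol law f hf).outbox o ((I.toProtocol law f hf).run o t) o.1 w =
      I.send o.1 o.1 (I.data law f hf o o.1) B w := by
  rw [outbox_eq, h.leader_active, h.leader_received]; simp

/-- A question and its answer take two rounds: in the second one `v` alone is active, and it has
received `cnt v + 1` questions, so it sends the bit with index `cnt v`. -/
theorem ask (h : AtRest I law f hf o t B cnt) {v : Fin n} {us : List (Fin n)} (hv : v ≠ o.1)
    (hs : (I.state o.1 (I.data law f hf o o.1) B).1 = v :: us) :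
    AtRest I law f hf o (t + 2) (B ++ [I.ans (I.data law f hf o v) (cnt v)])
      (Function.update cnt v (cnt v + 1)) := by
  have hl : ∀ w, (I.toProtocol law f hf).outbox o ((I.toProtocol law f hf).run o t) o.1 w =
      if w = v then [true] else [] := by
    intro w
    rw [h.leader_outbox, send, if_pos rfl, hs]
  have hin : ∀ w, (I.toProtocol law f hf).inbox o ((I.toProtocol law f hf).run o t) w =
      if w = v then [true] else [] := by
    intro w
    rw [(I.toProtocol law f hf).inbox_eq_of_forall_ne o.1 fun u hu => h.outbox_eq_nil hu w, hl]
  have hrec : ∀ w, ((I.toProtocol law f hf).run o (t + 1)).received w =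
      ((I.toProtocol law f hf).run o t).received w ++ if w = v then [true] else [] := fun w => by
    rw [(I.toProtocol law f hf).run_succ]; simp [Protocol.step, hin]
  have hact : ∀ w, ((I.toProtocol law f hf).run o (t + 1)).active w = decide (w = v) := fun w => by
    rw [(I.toProtocol law f hf).run_succ]
    by_cases hw : w = v <;> simp [Protocol.step, hin, hw]
  have hrv : ((I.toProtocol law f hf).run o (t + 1)).received v =
      List.replicate (cnt v + 1) true := by
    rw [hrec, h.received v hv, List.replicate_succ']; simp
  have hout' : ∀ u w, (I.toProtocol law f hf).outbox o ((I.toProtocol law f hf).run o (t + 1)) u w =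
      if u = v ∧ w = o.1 then [I.ans (I.data law f hf o v) (cnt v)] else [] := by
    intro u w
    rw [outbox_eq, hact]
    by_cases hu : u = v
    · subst hu
      rw [hrv, send, if_neg hv]
      by_cases hw : w = o.1 <;> simp [hw]
    · simp [hu]
  have hin' : ∀ w, (I.toProtocol law f hf).inbox o ((I.toProtocol law f hf).run o (t + 1)) w =
      if w = o.1 then [I.ans (I.data law f hf o v) (cnt v)] else [] := by
    intro w
    rw [(I.toProtocol law f hf).inbox_eq_of_forall_ne v fun u hu => by simp [hout', hu], hout']
    simp
  have hrec' : ∀ w, ((I.toProtocol law f hf).run o (t + 2)).received w =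
      ((I.toProtocol law f hf).run o (t + 1)).received w ++
      if w = o.1 then [I.ans (I.data law f hf o v) (cnt v)] else [] := fun w => by
    rw [(I.toProtocol law f hf).run_succ]; simp [Protocol.step, hin']
  have hact' : ∀ w, ((I.toProtocol law f hf).run o (t + 2)).active w = decide (w = o.1) :=
      fun w => by
    rw [(I.toProtocol law f hf).run_succ]
    by_cases hw : w = o.1 <;> simp [Protocol.step, hin', hw]
  refine ⟨?_, fun u hu => ?_, ?_, fun u hu => ?_, ?_, fun u => ?_⟩
  · rw [hrec', hrec, h.leader_received]; simp [hv.symm]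
  · rw [hrec', hrec, h.received u hu]
    by_cases huv : u = v
    · subst huv; simp [hu, List.replicate_succ']
    · simp [huv, hu]
  · rw [hact']; simp
  · rw [hact']; simp [hu]
  · rw [Function.update_of_ne hv.symm, h.cnt_leader]
  · rw [Finset.sum_range_succ, Finset.sum_range_succ, h.bits u]
    have h1 : (I.toProtocol law f hf).roundBits o ((I.toProtocol law f hf).run o t) u =
        if u = v ∨ u = o.1 then 1 else 0 := by
      rw [Protocol.roundBits, hin]
      by_cases hu : u = o.1
      · subst hu; simp [hl, hv.symm, apply_ite List.length]
      · simp [h.outbox_eq_nil hu, hu, apply_ite List.length]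
    have h2 : (I.toProtocol law f hf).roundBits o ((I.toProtocol law f hf).run o (t + 1)) u =
        if u = v ∨ u = o.1 then 1 else 0 := by
      rw [Protocol.roundBits, hin']
      by_cases hu : u = o.1
      · subst hu; simp [hout', hv.symm]
      · by_cases huv : u = v <;> simp [hout', hu, huv, apply_ite List.length, hv]
    rw [h1, h2]
    by_cases hu : u = o.1
    · have : ∑ w, Function.update cnt v (cnt v + 1) w = ∑ w, cnt w + 1 := by
        rw [Finset.sum_update_of_mem (Finset.mem_univ v),
          ← Finset.add_sum_erase _ cnt (Finset.mem_univ v), Finset.sdiff_singleton_eq_erase]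
        ring
      simp [hu, this]; ring
    · by_cases huv : u = v
      · subst huv; simp [hu]; ring
      · simp [hu, huv]

/-- Two more rounds suffice: the closing messages are delivered, and then their recipients act but
send nothing because of the marker `false`. -/
theorem closing (h : AtRest I law f hf o t B cnt) {cur : List Bool} {r : Fin n → G}
    (hs : I.state o.1 (I.data law f hf o o.1) B = ([], cur, r)) :
    (∀ u, (I.toProtocol law f hf).bits o u =
      ((if u = o.1 then 2 * ∑ w, cnt w +
          ∑ w, (if w = o.1 then 0 else 1 + (I.closing (I.data law f hf o o.1) r w).length)
        else 2 * cnt u + (1 + (I.closing (I.data law f hf o o.1) r u).length) : ℕ) : ℝ≥0∞)) ∧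
    ∀ y, I.leaderOut (I.data law f hf o o.1) r = y →
      (∀ u, u ≠ o.1 →
        I.out (I.data law f hf o u) (I.closing (I.data law f hf o o.1) r u) = y) →
      (I.toProtocol law f hf).AllOutput o y := by
  have hl : ∀ w, (I.toProtocol law f hf).outbox o ((I.toProtocol law f hf).run o t) o.1 w =
      if w = o.1 then [] else false :: I.closing (I.data law f hf o o.1) r w := by
    intro w
    rw [h.leader_outbox, send, if_pos rfl, hs]
  have hin : ∀ w, (I.toProtocol law f hf).inbox o ((I.toProtocol law f hf).run o t) w =
      if w = o.1 then [] else false :: I.closing (I.data law f hf o o.1) r w := by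
    intro w
    rw [(I.toProtocol law f hf).inbox_eq_of_forall_ne o.1 fun u hu => h.outbox_eq_nil hu w, hl]
  have hrec : ∀ w, ((I.toProtocol law f hf).run o (t + 1)).received w =
      ((I.toProtocol law f hf).run o t).received w ++
      if w = o.1 then [] else false :: I.closing (I.data law f hf o o.1) r w := fun w => by
    rw [(I.toProtocol law f hf).run_succ]; simp [Protocol.step, hin]
  have hact : ∀ w, ((I.toProtocol law f hf).run o (t + 1)).active w = !decide (w = o.1) :=
      fun w => by
    rw [(I.toProtocol law f hf).run_succ]
    by_cases hw : w = o.1 <;> simp [Protocol.step, hin, hw]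
  have hout' : ∀ u w, (I.toProtocol law f hf).outbox o ((I.toProtocol law f hf).run o (t + 1)) u w =
      [] := by
    intro u w
    rw [outbox_eq, hact, hrec]
    by_cases hu : u = o.1
    · simp [hu]
    · simp [hu, send]
  have hin' : ∀ w, (I.toProtocol law f hf).inbox o ((I.toProtocol law f hf).run o (t + 1)) w = [] :=
      fun w =>
    (I.toProtocol law f hf).inbox_eq_nil fun u => hout' u w
  have hrec' : ∀ w, ((I.toProtocol law f hf).run o (t + 2)).received w =
      ((I.toProtocol law f hf).run o (t + 1)).received w := fun w => by
    rw [(I.toProtocol law f hf).run_succ]; simp [Protocol.step, hin']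
  have hact' : ∀ w, ((I.toProtocol law f hf).run o (t + 2)).active w = false := fun w => by
    rw [(I.toProtocol law f hf).run_succ]; simp [Protocol.step, hin']
  refine ⟨fun u => ?_, fun y hy hy' => ⟨t + 2, hact', fun u => ?_⟩⟩
  · rw [(I.toProtocol law f hf).bits_eq_of_inactive hact', Nat.cast_inj, Finset.sum_range_succ,
        Finset.sum_range_succ,
      h.bits u]
    have h1 : (I.toProtocol law f hf).roundBits o ((I.toProtocol law f hf).run o (t + 1)) u =
        0 := by
      simp [Protocol.roundBits, hin', hout']
    rw [h1, Protocol.roundBits, hin]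
    by_cases hu : u = o.1
    · subst hu
      simp only [hl, if_true, List.length_nil, zero_add, add_zero]
      congr 1
      refine Finset.sum_congr rfl fun w _ => ?_
      split_ifs <;> simp [add_comm]
    · simp only [h.outbox_eq_nil hu, hu, if_false, List.length_nil, Finset.sum_const_zero,
        List.length_cons]
      ring
  · change I.output o.1 u (I.data law f hf o u) (((I.toProtocol law f hf).run o (t + 2)).received u)
        = y
    rw [hrec', hrec, output]
    by_cases hu : u = o.1
    · subst hu
      rw [if_pos rfl, h.leader_received]
      simp [hs, hy]
    · rw [if_neg hu, h.received u hu, ← hy' u hu]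
      congr 1
      have : ∀ m : ℕ, ∀ c : List Bool,
          (List.replicate m true ++ false :: c).dropWhile id = false :: c := by
        intro m c
        induction m with
        | zero => simp
        | succ m ih => simp [List.replicate_succ]
      simp [hu, this]

end AtRest

section

variable {M : Fin n → ℕ} {W : Fin n → G}

/-- Induction on the number `i + 1` of questions that `v` has yet to answer; the invariant is that
the leader's buffer holds precisely the first `j` bits of the answer of `v`. -/
theorem exists_atRest_of_answer {v : Fin n} {us : List (Fin n)} {r : Fin n → G} (hv : v ≠ o.1)
    (hnone : ∀ m, 0 < m → m < M v →
      I.dec (I.data law f hf o o.1) (I.stream (I.data law f hf o v) m) = none)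
    (hsome : I.dec (I.data law f hf o o.1) (I.stream (I.data law f hf o v) (M v)) = some (W v))
    (i : ℕ) : ∀ {j t : ℕ} {B : List Bool} {cnt : Fin n → ℕ}, j + i + 1 = M v →
      AtRest I law f hf o t B cnt → cnt v = j →
      I.state o.1 (I.data law f hf o o.1) B = (v :: us, I.stream (I.data law f hf o v) j, r) →
      ∃ t' B', AtRest I law f hf o t' B' (Function.update cnt v (M v)) ∧
        I.state o.1 (I.data law f hf o o.1) B' = (us, [], Function.update r v (W v)) := by
  induction i with
  | zero =>
    intro j t B cnt hj h hc hs
    have h' := h.ask hv (us := us) (by rw [hs])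
    rw [hc, show j + 1 = M v by omega] at h'
    refine ⟨_, _, h', ?_⟩
    rw [state_append, hs]
    simp only [advance]
    rw [← stream_succ, show j + 1 = M v by omega, hsome]
  | succ i ih =>
    intro j t B cnt hj h hc hs
    have h' := h.ask hv (us := us) (by rw [hs])
    rw [hc] at h'
    have := ih (j := j + 1) (by omega) h' (by simp) (by
      rw [state_append, hs]
      simp only [advance]
      rw [← stream_succ, hnone (j + 1) (by omega) (by omega)])
    simpa using this

/-- Induction on the list of outstanding machines; these have sent no bits and still have the
default entry. -/
theorem exists_atRest_of_answers (hM : ∀ u, u ≠ o.1 → 0 < M u)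
    (hnone : ∀ u, u ≠ o.1 → ∀ m, 0 < m → m < M u →
      I.dec (I.data law f hf o o.1) (I.stream (I.data law f hf o u) m) = none)
    (hsome : ∀ u, u ≠ o.1 →
      I.dec (I.data law f hf o o.1) (I.stream (I.data law f hf o u) (M u)) = some (W u))
    (us : List (Fin n)) : ∀ {t : ℕ} {B : List Bool}, us.Nodup → o.1 ∉ us →
      AtRest I law f hf o t B (fun u => if u ∈ us then 0 else M u) →
      I.state o.1 (I.data law f hf o o.1) B = (us, [], fun u => if u ∈ us then default else W u) →
      ∃ t' B', AtRest I law f hf o t' B' M ∧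
        I.state o.1 (I.data law f hf o o.1) B' = ([], [], W) := by
  induction us with
  | nil =>
    intro t B _ _ h hs
    exact ⟨t, B, by simpa using h, by simpa using hs⟩
  | cons v us ih =>
    intro t B hnd hl h hs
    have hv : v ≠ o.1 := by rintro rfl; simp at hl
    have hvus := (List.nodup_cons.1 hnd).1
    obtain ⟨t', B', h', hs'⟩ := exists_atRest_of_answer hv (hnone v hv) (hsome v hv) (M v - 1)
      (j := 0) (by have := hM v hv; omega) h (by simp) (by simpa [stream] using hs)
    refine ih (t := t') (B := B') (List.nodup_cons.1 hnd).2 (fun hm => hl (by simp [hm])) ?_ ?_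
    · convert h' using 1
      ext u
      by_cases hu : u = v
      · subst hu; simp [hvus]
      · simp [hu]
    · rw [hs']
      congr 2
      ext u
      by_cases hu : u = v
      · subst hu; simp [hvus]
      · simp [hu]

/-- The cost and the outcome of an interrogation in which the leader decodes the answer of machine
`u` as `W u` after `M u` bits. -/
theorem bits_and_allOutput (hMl : M o.1 = 0) (hWl : W o.1 = default)
    (hM : ∀ u, u ≠ o.1 → 0 < M u)
    (hnone : ∀ u, u ≠ o.1 → ∀ m, 0 < m → m < M u →
      I.dec (I.data law f hf o o.1) (I.stream (I.data law f hf o u) m) = none)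
    (hsome : ∀ u, u ≠ o.1 →
      I.dec (I.data law f hf o o.1) (I.stream (I.data law f hf o u) (M u)) = some (W u)) :
    (∀ u, (I.toProtocol law f hf).bits o u =
      ((if u = o.1 then 2 * ∑ w, M w +
          ∑ w, (if w = o.1 then 0 else 1 + (I.closing (I.data law f hf o o.1) W w).length)
        else 2 * M u + (1 + (I.closing (I.data law f hf o o.1) W u).length) : ℕ) : ℝ≥0∞)) ∧
    ∀ y, I.leaderOut (I.data law f hf o o.1) W = y →
      (∀ u, u ≠ o.1 →
        I.out (I.data law f hf o u) (I.closing (I.data law f hf o o.1) W u) = y) →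
      (I.toProtocol law f hf).AllOutput o y := by
  have hus : ∀ u, u ∈ (List.finRange n).filter (· ≠ o.1) ↔ u ≠ o.1 := by simp
  obtain ⟨t, B, h, hs⟩ := exists_atRest_of_answers hM hnone hsome
    ((List.finRange n).filter (· ≠ o.1)) (t := 0) (B := [])
    ((List.nodup_finRange n).filter _) (by simp)
    (by
      convert atRest_zero using 1
      ext u
      by_cases hu : u = o.1
      · simp [hu, hMl]
      · simp [hu])
    (by
      simp only [state, List.foldl_nil]
      congr 2
      ext u
      by_cases hu : u = o.1
      · simp [hu, hWl]
      · simp [hu])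
  exact h.closing hs

end

end Interrogation

/-! ### The interrogation for mean estimation -/

section

variable {d n s b p L J : ℕ} [Fact p.Prime] [NeZero L] [NeZero J]

/-- The `j`-th bit of the answer of a machine whose quantized input is `v` modulo `p`: the answer
consists of blocks of `L` bits, each of which encodes a random hash function and the hash of `v`. -/
def answerBit (enc : ZMod p × ZMod p → Fin L → Bool) (v : Fin d → ZMod p) (a : Fin J → ZMod p)
    (j : ℕ) : Bool :=
  enc (a (Fin.ofNat J (j / L)), polyHash (a (Fin.ofNat J (j / L))) v) (Fin.ofNat L j)

/-- The residues of an integer vector. -/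
def residue (p : ℕ) (v : Fin d → ℤ) : Fin d → ZMod p := fun i => (v i : ZMod p)

/-- The integer vector of least absolute values with the given residues. -/
def leastAbs (w : Fin d → ZMod p) : Fin d → ℤ := fun i => (w i).valMinAbs

omit [Fact p.Prime] in
theorem leastAbs_injective : Function.Injective (leastAbs (d := d) (p := p)) := fun _ _ h =>
  funext fun i => ZMod.injective_valMinAbs (congrFun h i)

/-- Reduction modulo `p` never moves a vector away from 0, so even after a wraparound the leader's
search ends within the true distance. -/
theorem sumAbs_leastAbs_residue_le (v : Fin d → ℤ) : sumAbs (leastAbs (residue p v)) ≤ sumAbs v :=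
  Finset.sum_le_sum fun i _ => by
    refine ZMod.natAbs_min_of_le_div_two p _ _ ?_ (ZMod.natAbs_valMinAbs_le _)
    simp [leastAbs, residue]

theorem sumAbs_leastAbs_le (w : Fin d → ZMod p) : sumAbs (leastAbs w) ≤ d * p := by
  calc sumAbs (leastAbs w) ≤ ∑ _i : Fin d, p :=
        Finset.sum_le_sum fun i _ => (ZMod.natAbs_valMinAbs_le _).trans (Nat.div_le_self _ _)
    _ = d * p := by simp

theorem leastAbs_residue {v : Fin d → ℤ} (hv : 2 * sumAbs v < p) : leastAbs (residue p v) = v := by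
  ext i
  have h1 : (v i).natAbs ≤ sumAbs v :=
    Finset.single_le_sum (f := fun i => (v i).natAbs) (fun _ _ => Nat.zero_le _) (Finset.mem_univ i)
  exact (ZMod.valMinAbs_spec _ _).2 ⟨rfl, by constructor <;> omega⟩

theorem residue_sub (v w : Fin d → ℤ) : residue p (v - w) = residue p v - residue p w := by
  ext i; simp [residue]

/-- The residue vectors `w` that the leader takes into consideration after the bits `cur` of an
answer, if its own quantized input is `v`: those that are small and such that `v + w` could have
produced these bits. -/
def IsCandidate (enc : ZMod p × ZMod p → Fin L → Bool) (J s b : ℕ) [NeZero J] (v : Fin d → ℤ)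
    (cur : List Bool) (w : Fin d → ZMod p) : Prop :=
  -- At least one complete block is required, since otherwise the zero vector could be accepted
  -- without evidence. The hash functions are quantified existentially because the leader learns
  -- them only from the blocks.
  L ≤ cur.length ∧ sumAbs (leastAbs w) ≤ s * b * (cur.length / L) ∧
    ∃ a : Fin J → ZMod p, (List.range cur.length).map (answerBit enc (residue p v + w) a) = cur

/-- The randomly rounded average of the quantized inputs `v + leastAbs (r u)`. -/
def roundedMean (v : Fin d → ℤ) (U : Fin n) (r : Fin n → Fin d → ZMod p) : Fin d → ℤ := fun i =>
  (∑ u, (v i + leastAbs (r u) i) + (U : ℕ)) / n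

open Classical in
/-- The interrogation in which the leader learns the quantized inputs. The local data of a machine
are its quantized input, the randomness of the final rounding, and its hash functions. -/
noncomputable def estimation {E : Type} (n : ℕ) (enc : ZMod p × ZMod p → Fin L → Bool) (s b : ℕ)
    (scale : (Fin d → ℤ) → E) :
    Interrogation n E ((Fin d → ℤ) × Fin n × (Fin J → ZMod p)) (Fin d → ZMod p) where
  ans D j := answerBit enc (residue p D.1) D.2.2 j
  dec D cur := if h : ∃ w, IsCandidate enc J s b D.1 cur w then some h.choose else none
  -- Relative to the vector that the leader attributes to `u`, so that `u` recovers the mean by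
  -- adding its own vector if the attribution is right.
  closing D r u := vecCode (roundedMean D.1 D.2.1 r - (D.1 + leastAbs (r u)))
  out D c := scale (D.1 + Function.invFun vecCode c)
  leaderOut D r := scale (roundedMean D.1 D.2.1 r)

/-- The hash functions `a` do not tell the residues `w` from some other small residues. -/
def Collision (s b : ℕ) (w : Fin d → ZMod p) (a : Fin J → ZMod p) : Prop :=
  -- `j + 1` is the number of complete blocks when the leader decodes: it fixes the search radius,
  -- and the hash functions up to index `j` are in use.
  ∃ j : Fin J, ∃ w' : Fin d → ZMod p, w' ≠ w ∧ sumAbs (leastAbs w') ≤ s * b * (j + 1) ∧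
    ∀ i ≤ j, polyHash (a i) (w' - w) = 0

/-- A complete block determines both the point and the value, so equal blocks force `a i = a' i` and
equal hashes; by additivity the difference then hashes to 0. An incomplete block is not exploited,
whence `m / L`. -/
theorem stream_eq_imp {enc : ZMod p × ZMod p → Fin L → Bool} (henc : Function.Injective enc)
    {v v' : Fin d → ZMod p} {a a' : Fin J → ZMod p} {m : ℕ}
    (h : (List.range m).map (answerBit enc v a) = (List.range m).map (answerBit enc v' a'))
    (i : Fin J) (hi : (i : ℕ) < m / L) : polyHash (a i) (v - v') = 0 := by
  have hbit : ∀ j < m, answerBit enc v a j = answerBit enc v' a' j := fun j hj =>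
    (List.map_inj_left.1 h) j (List.mem_range.2 hj)
  have hblock : enc (a i, polyHash (a i) v) = enc (a' i, polyHash (a' i) v') := by
    ext e
    have hL : 0 < L := NeZero.pos L
    have h1 := hbit (L * i + e) (by
      have h3 : ((i : ℕ) + 1) * L ≤ m := (Nat.le_div_iff_mul_le hL).1 hi
      have := e.2
      nlinarith)
    have h2 : Fin.ofNat J ((L * i + e) / L) = i := by
      ext
      rw [Nat.mul_add_div hL, Nat.div_eq_of_lt e.2]
      simp
    have h3 : Fin.ofNat L (L * i + e) = e := by
      ext
      simp [Nat.mod_eq_of_lt e.2]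
    rwa [answerBit, answerBit, h2, h3] at h1
  have := henc hblock
  simp only [Prod.mk.injEq] at this
  rw [polyHash_sub, sub_eq_zero, this.2, this.1]

variable {E : Type} {enc : ZMod p × ZMod p → Fin L → Bool} {scale : (Fin d → ℤ) → E}

/-- The true residues are consistent with every prefix of the answer, so they are a candidate as
soon as the radius reaches them, and the leader stops then at the latest. Only the last clause needs
the absence of collisions: the bounds on length and size hold always and thus control the expected
cost. `hJ` ensures that the hash functions are not exhausted before. -/
theorem exists_decoded (henc : Function.Injective enc) (hsb : 0 < s * b) (hJ : d * p < J)
    (D D' : (Fin d → ℤ) × Fin n × (Fin J → ZMod p)) :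
    ∃ (m : ℕ) (w : Fin d → ZMod p), 0 < m ∧
      (∀ m', 0 < m' → m' < m → (estimation n enc s b scale).dec D
        ((estimation n enc s b scale).stream D' m') = none) ∧
      (estimation n enc s b scale).dec D ((estimation n enc s b scale).stream D' m) = some w ∧
      m ≤ L * (sumAbs (D'.1 - D.1) / (s * b) + 1) ∧
      sumAbs (leastAbs w) ≤ s * b * (m / L) ∧
      (¬ Collision s b (residue p (D'.1 - D.1)) D'.2.2 → w = residue p (D'.1 - D.1)) := by
  classical
  set I := estimation (E := E) (J := J) n enc s b scale with hI
  have hlen : ∀ m, (I.stream D' m).length = m := fun m => by simp [Interrogation.stream]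
  have hL : 0 < L := NeZero.pos L
  set S := sumAbs (leastAbs (residue p (D'.1 - D.1))) with hS
  have hdec : ∀ m w, I.dec D (I.stream D' m) = some w →
      IsCandidate enc J s b D.1 (I.stream D' m) w := by
    intro m w h
    simp only [hI, estimation] at h
    split_ifs at h with h'
    exact Option.some.inj h ▸ h'.choose_spec
  have hex : 0 < L * (S / (s * b) + 1) ∧
      (I.dec D (I.stream D' (L * (S / (s * b) + 1)))).isSome := by
    refine ⟨by positivity, ?_⟩
    have : ∃ w, IsCandidate enc J s b D.1 (I.stream D' (L * (S / (s * b) + 1))) w := by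
      refine ⟨residue p (D'.1 - D.1), ?_, ?_, D'.2.2, ?_⟩
      · rw [hlen]; exact Nat.le_mul_of_pos_right _ (Nat.succ_pos _)
      · rw [hlen, Nat.mul_div_cancel_left _ hL]
        exact (Nat.lt_mul_div_succ S hsb).le
      · rw [hlen, residue_sub, add_sub_cancel]
        rfl
    have h : I.dec D (I.stream D' (L * (S / (s * b) + 1))) = some this.choose := dif_pos this
    simp [h]
  have hne : ∃ m, 0 < m ∧ (I.dec D (I.stream D' m)).isSome := ⟨_, hex⟩
  obtain ⟨w, hw⟩ := Option.isSome_iff_exists.1 (Nat.find_spec hne).2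
  have hm : Nat.find hne ≤ L * (S / (s * b) + 1) := Nat.find_min' hne hex
  have hc := hdec _ _ hw
  refine ⟨Nat.find hne, w, (Nat.find_spec hne).1, fun m' h0 hlt => ?_, hw, ?_, ?_, ?_⟩
  · have := Nat.find_min hne hlt
    simpa [h0] using this
  · exact hm.trans (by gcongr; exact sumAbs_leastAbs_residue_le _)
  · simpa only [hlen] using hc.2.1
  · intro hcol
    by_contra hwne
    obtain ⟨hc1, hc2, a, ha⟩ := hc
    rw [hlen] at hc1 hc2 ha
    have hpos : 0 < Nat.find hne / L := Nat.div_pos hc1 hL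
    have hle : Nat.find hne / L ≤ S / (s * b) + 1 := by
      rw [Nat.div_le_iff_le_mul_add_pred hL]
      omega
    have hSJ : S / (s * b) < J :=
      lt_of_le_of_lt (Nat.div_le_self _ _) (lt_of_le_of_lt (sumAbs_leastAbs_le _) hJ)
    refine hcol ⟨⟨Nat.find hne / L - 1, by omega⟩, w, hwne, ?_, fun i hi => ?_⟩
    · simpa [Nat.sub_add_cancel hpos] using hc2
    · have hi' : (i : ℕ) < Nat.find hne / L := by
        have : (i : ℕ) ≤ Nat.find hne / L - 1 := hi
        omega
      have ha' : (List.range (Nat.find hne)).map (answerBit enc (residue p D'.1) D'.2.2) =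
          (List.range (Nat.find hne)).map (answerBit enc (residue p D.1 + w) a) := by
        rw [ha]; rfl
      have := stream_eq_imp henc ha' i hi'
      rw [show w - residue p (D'.1 - D.1) = -(residue p D'.1 - (residue p D.1 + w)) by
        rw [residue_sub]; abel, ← zero_sub, polyHash_sub, this]
      simp [polyHash]

omit [Fact p.Prime] in
-- Multiplication by `n` keeps the estimate in the integers; the rounding accounts for the summand
-- `n` in each coordinate.
theorem sumAbs_roundedMean_sub_le (v : Fin d → ℤ) (U : Fin n) (r : Fin n → Fin d → ZMod p) :
    n * sumAbs (roundedMean v U r - v) ≤ n * d + ∑ u, sumAbs (leastAbs (r u)) := by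
  have hn : (0 : ℤ) < n := by exact_mod_cast U.pos
  have key : ∀ i, n * (roundedMean v U r i - v i).natAbs ≤
      n + ∑ u, (leastAbs (r u) i).natAbs := by
    intro i
    have h1 : roundedMean v U r i - v i = (∑ u, leastAbs (r u) i + (U : ℕ)) / n := by
      rw [roundedMean, Finset.sum_add_distrib]
      simp only [Finset.sum_const, Finset.card_univ, Fintype.card_fin, nsmul_eq_mul]
      rw [add_assoc, Int.mul_add_ediv_left _ _ hn.ne']
      ring
    have h2 : (∑ u, leastAbs (r u) i).natAbs ≤ ∑ u, (leastAbs (r u) i).natAbs :=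
      Int.natAbs_sum_le _ _
    have h3 := Int.mul_ediv_add_emod (∑ u, leastAbs (r u) i + (U : ℕ)) n
    have h4 := Int.emod_nonneg (∑ u, leastAbs (r u) i + (U : ℕ)) hn.ne'
    have h5 := Int.emod_lt_of_pos (∑ u, leastAbs (r u) i + (U : ℕ)) hn
    have h6 : (n * (roundedMean v U r i - v i).natAbs : ℕ) =
        ((n : ℤ) * ((∑ u, leastAbs (r u) i + (U : ℕ)) / n)).natAbs := by
      rw [h1, Int.natAbs_mul]; simp
    rw [h6]
    have := U.2
    omega
  simp only [sumAbs]
  rw [Finset.mul_sum, Finset.sum_comm]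
  calc _ ≤ ∑ i, (n + ∑ u, (leastAbs (r u) i).natAbs) := Finset.sum_le_sum fun i _ => key i
    _ = _ := by rw [Finset.sum_add_distrib]; simp [mul_comm]

end

/-- The average of integer vectors, rounded with the help of `U`. -/
def intMean {d n : ℕ} (v : Fin n → Fin d → ℤ) (U : Fin n) : Fin d → ℤ := fun i =>
  (∑ u, v u i + (U : ℕ)) / n

/-! ### Cost and outcome of the interrogation for mean estimation -/

section

variable {d n s b p L J : ℕ} [Fact p.Prime] [NeZero L] [NeZero J] {E : Type} [MeasurableSpace E]
  {enc : ZMod p × ZMod p → Fin L → Bool} {scale : (Fin d → ℤ) → E} {Seed : Type}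
  [MeasurableSpace Seed] {law : Measure Seed} [IsProbabilityMeasure law]
  [MeasurableSpace ((Fin d → ℤ) × Fin n × (Fin J → ZMod p))]
  [DiscreteMeasurableSpace ((Fin d → ℤ) × Fin n × (Fin J → ZMod p))]
  {f : E × Seed → (Fin d → ℤ) × Fin n × (Fin J → ZMod p)} {hf : Measurable f}

/-- `c u` is the cost of the conversation between the leader and `u`, borne by both. In `2 * κ +
14`, the part `2 * κ` is for questions and answers; the closing message takes `b ≥ 1` for its
marker, `b` for the fixed part of the code and `4 * 3 * b` for the search radii and the rounding. -/
theorem estimation_execution (henc : Function.Injective enc) (hs : 0 < s) (hdb : d ≤ b)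
    (hb : 0 < b) (hsize : d * (2 * s.size + 1) ≤ b) {κ : ℕ} (hL : L ≤ κ * b) (hJ : d * p < J)
    {I : Interrogation n E ((Fin d → ℤ) × Fin n × (Fin J → ZMod p)) (Fin d → ZMod p)}
    (hI : I = estimation n enc s b scale)
    (o : (I.toProtocol law f hf).Outcome)
    {D : Fin n → (Fin d → ℤ) × Fin n × (Fin J → ZMod p)}
    (hD : D = I.data law f hf o) :
    (∃ c : Fin n → ℕ, (∀ u, (I.toProtocol law f hf).bits o u =
      ((if u = o.1 then ∑ w, (if w = o.1 then 0 else c w) else c u : ℕ) : ℝ≥0∞)) ∧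
      ∀ u, u ≠ o.1 → (c u : ℝ) ≤ (2 * κ + 14) * (b + sumAbs ((D u).1 - (D o.1).1) / s +
        (∑ w, (sumAbs ((D w).1 - (D o.1).1) : ℝ)) / (n * s))) ∧
    ((∀ u, u ≠ o.1 → ¬ Collision s b (residue p ((D u).1 - (D o.1).1)) (D u).2.2 ∧
        2 * sumAbs ((D u).1 - (D o.1).1) < p) →
      (I.toProtocol law f hf).AllOutput o
        (scale (intMean (fun u => (D u).1) (D o.1).2.1))) := by
  classical
  have hsb : 0 < s * b := Nat.mul_pos hs hb
  have hn : 0 < n := o.1.pos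
  have hL0 : 0 < L := NeZero.pos L
  choose M₀ W₀ hM₀ hnone hsome hM₁ hW₁ hcol using
    fun u => exists_decoded (n := n) (scale := scale) henc hsb hJ (D o.1) (D u)
  simp only [← hI] at hnone hsome
  let M : Fin n → ℕ := fun u => if u = o.1 then 0 else M₀ u
  -- The leader is not asked; its entry is 0, the difference from its own vector.
  let W : Fin n → Fin d → ZMod p := fun u => if u = o.1 then default else W₀ u
  have hdef : (default : Fin d → ZMod p) = 0 := by ext i; rfl
  have hlift0 : sumAbs (leastAbs (0 : Fin d → ZMod p)) = 0 := by simp [sumAbs, leastAbs]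
  obtain ⟨h1, h2⟩ := Interrogation.bits_and_allOutput (I := I) (law := law) (f := f) (hf := hf)
    (o := o) (M := M) (W := W) (by simp [M]) (by simp [W])
    (fun u hu => by simpa [M, hu] using hM₀ u)
    (fun u hu m h0 hm => by
      rw [← hD]
      exact hnone u m h0 (by simpa [M, hu] using hm))
    (fun u hu => by
      rw [← hD]
      simpa [M, W, hu] using hsome u)
  rw [← hD] at h1 h2
  constructor
  · refine ⟨fun u => 2 * M u + (1 + (I.closing (D o.1) W u).length), fun u => ?_, fun u hu => ?_⟩
    · rw [h1, Nat.cast_inj]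
      split_ifs with hu
      · rw [Finset.mul_sum, ← Finset.sum_add_distrib]
        refine Finset.sum_congr rfl fun w _ => ?_
        by_cases hw : w = o.1 <;> simp [hw, M]
      · rfl
    · set S : Fin n → ℕ := fun w => sumAbs ((D w).1 - (D o.1).1) with hS
      have hWS : ∀ w, sumAbs (leastAbs (W w)) ≤ S w + s * b := by
        intro w
        by_cases hw : w = o.1
        · simp [W, hw, hdef, hlift0]
        · simp only [W, hw, if_false]
          refine (hW₁ w).trans ?_
          have h3 : M₀ w / L ≤ S w / (s * b) + 1 := by
            rw [Nat.div_le_iff_le_mul_add_pred hL0]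
            exact (hM₁ w).trans (Nat.le_add_right _ _)
          calc s * b * (M₀ w / L) ≤ s * b * (S w / (s * b) + 1) := Nat.mul_le_mul_left _ h3
            _ = s * b * (S w / (s * b)) + s * b := by ring
            _ ≤ _ := Nat.add_le_add_right (Nat.mul_div_le _ _) _
      have hs' : (0 : ℝ) < s := by exact_mod_cast hs
      have hb' : (0 : ℝ) < b := by exact_mod_cast hb
      have hn' : (0 : ℝ) < n := by exact_mod_cast hn
      have hMu : (M u : ℝ) ≤ κ * b + κ * (S u / s) := by
        have h3 : (M u : ℝ) ≤ L * (S u / (s * b) + 1) := by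
          have h4 := hM₁ u
          have h5 : ((S u / (s * b) : ℕ) : ℝ) ≤ S u / (s * b) := by
            simpa using Nat.cast_div_le (α := ℝ) (m := S u) (n := s * b)
          simp only [M, hu, if_false]
          calc (M₀ u : ℝ) ≤ ((L * (S u / (s * b) + 1) : ℕ) : ℝ) := by exact_mod_cast h4
            _ ≤ _ := by push_cast; gcongr
        have h6 : (L : ℝ) ≤ κ * b := by exact_mod_cast hL
        calc (M u : ℝ) ≤ L * (S u / (s * b) + 1) := h3
          _ ≤ κ * b * (S u / (s * b) + 1) := by gcongr
          _ = _ := by field_simp; ring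
      have hclose : ((I.closing (D o.1) W u).length : ℝ) ≤
          b + 4 * ((d + (∑ w, (sumAbs (leastAbs (W w)) : ℝ)) / n +
            sumAbs (leastAbs (W u))) / s) := by
        set y := roundedMean (D o.1).1 (D o.1).2.1 W with hy
        have h3 := length_vecCode_le hs (y - ((D o.1).1 + leastAbs (W u)))
        have hcl : I.closing (D o.1) W u = vecCode (y - ((D o.1).1 + leastAbs (W u))) := by
          rw [hI]; rfl
        rw [hcl]
        have h4 : sumAbs (y - ((D o.1).1 + leastAbs (W u))) ≤
            sumAbs (y - (D o.1).1) + sumAbs (leastAbs (W u)) := by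
          rw [← sub_sub]; exact sumAbs_sub_le _ _
        have h5 := sumAbs_roundedMean_sub_le (D o.1).1 (D o.1).2.1 W
        rw [← hy] at h5
        have h6 : (sumAbs (y - (D o.1).1) : ℝ) ≤
            d + (∑ w, (sumAbs (leastAbs (W w)) : ℝ)) / n := by
          have : (n : ℝ) * sumAbs (y - (D o.1).1) ≤
            n * d + ∑ w, (sumAbs (leastAbs (W w)) : ℝ) := by exact_mod_cast h5
          rw [← mul_le_mul_iff_right₀ hn']
          calc _ ≤ _ := this
            _ = _ := by field_simp
        have h7 : ((4 * sumAbs (y - ((D o.1).1 + leastAbs (W u))) / s : ℕ) : ℝ) ≤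
            4 * sumAbs (y - ((D o.1).1 + leastAbs (W u))) / s := by
          simpa using Nat.cast_div_le (α := ℝ)
            (m := 4 * sumAbs (y - ((D o.1).1 + leastAbs (W u)))) (n := s)
        calc ((vecCode (y - ((D o.1).1 + leastAbs (W u)))).length : ℝ)
            ≤ ((d * (2 * s.size + 1) +
                4 * sumAbs (y - ((D o.1).1 + leastAbs (W u))) / s : ℕ) : ℝ) := by
              exact_mod_cast h3
          _ ≤ b + 4 * sumAbs (y - ((D o.1).1 + leastAbs (W u))) / s := by
              rw [Nat.cast_add]
              exact add_le_add (by exact_mod_cast hsize) h7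
          _ ≤ _ := by
              rw [← mul_div_assoc]
              gcongr
              calc (sumAbs (y - ((D o.1).1 + leastAbs (W u))) : ℝ)
                  ≤ sumAbs (y - (D o.1).1) + sumAbs (leastAbs (W u)) := by exact_mod_cast h4
                _ ≤ _ := by gcongr
      have hWu : (sumAbs (leastAbs (W u)) : ℝ) ≤ S u + s * b := by exact_mod_cast hWS u
      have hsum : (∑ w, (sumAbs (leastAbs (W w)) : ℝ)) / n ≤ (∑ w, (S w : ℝ)) / n + s * b := by
        calc (∑ w, (sumAbs (leastAbs (W w)) : ℝ)) / n ≤ (∑ w, ((S w : ℝ) + s * b)) / n := by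
              gcongr with w
              exact_mod_cast hWS w
          _ = _ := by
              rw [Finset.sum_add_distrib]
              simp only [Finset.sum_const, Finset.card_univ, Fintype.card_fin, nsmul_eq_mul]
              field_simp
      have hd' : (d : ℝ) ≤ s * b := by
        have : d ≤ s * b := hdb.trans (Nat.le_mul_of_pos_left _ hs)
        exact_mod_cast this
      have hb1 : (1 : ℝ) ≤ b := by exact_mod_cast hb
      have hfin : (d + (∑ w, (sumAbs (leastAbs (W w)) : ℝ)) / n + sumAbs (leastAbs (W u))) / s ≤
          3 * b + S u / s + (∑ w, (S w : ℝ)) / (n * s) := by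
        rw [div_le_iff₀ hs']
        calc _ ≤ s * b + ((∑ w, (S w : ℝ)) / n + s * b) + (S u + s * b) := by gcongr
          _ = _ := by field_simp; ring
      have hA : (0 : ℝ) ≤ S u / s := by positivity
      have hB : (0 : ℝ) ≤ (∑ w, (S w : ℝ)) / (n * s) := by positivity
      have hκ : (0 : ℝ) ≤ κ := Nat.cast_nonneg κ
      push_cast
      nlinarith [mul_nonneg hκ hB, mul_nonneg hκ hA]
  · intro hgood
    have hW : ∀ u, leastAbs (W u) = (D u).1 - (D o.1).1 := by
      intro u
      by_cases hu : u = o.1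
      · subst hu
        ext i
        simp [W, leastAbs, hdef]
      · simp only [W, hu, if_false]
        rw [hcol u (hgood u hu).1, leastAbs_residue (hgood u hu).2]
    have hy : roundedMean (D o.1).1 (D o.1).2.1 W =
        intMean (fun u => (D u).1) (D o.1).2.1 := by
      ext i
      simp [roundedMean, intMean, hW]
    refine h2 _ ?_ fun u hu => ?_
    · simp only [hI, estimation, hy]
    · simp only [hI, estimation, hy, hW]
      rw [Function.leftInverse_invFun (vecCode_injective d)]
      simp

end

/-! ### Uniform distributions -/

section

variable {α : Type*} [MeasurableSpace α] [Fintype α]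

theorem uniformOn_univ_eq_smul :
    uniformOn (Set.univ : Set α) = (Fintype.card α : ℝ≥0∞)⁻¹ • Measure.count := by
  ext s _
  rw [uniformOn_univ, Measure.smul_apply, smul_eq_mul, ENNReal.div_eq_inv_mul]

variable [MeasurableSingletonClass α]

theorem uniformOn_univ_real (S : Finset α) :
    (uniformOn (Set.univ : Set α)).real S = S.card / Fintype.card α := by
  rw [measureReal_def, uniformOn_univ, Measure.count_apply_finset, ENNReal.toReal_div]
  simp

instance isProbabilityMeasure_uniformOn_univ [Nonempty α] :
    IsProbabilityMeasure (uniformOn (Set.univ : Set α)) :=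
  isProbabilityMeasure_uniformOn Set.finite_univ Set.univ_nonempty

theorem lintegral_uniformOn_univ (f : α → ℝ≥0∞) :
    ∫⁻ a, f a ∂(uniformOn Set.univ) = (Fintype.card α : ℝ≥0∞)⁻¹ * ∑ a, f a := by
  rw [uniformOn_univ_eq_smul, lintegral_smul_measure, lintegral_count, tsum_fintype, smul_eq_mul]

theorem integral_uniformOn_univ [Nonempty α] (f : α → ℝ) :
    ∫ a, f a ∂(uniformOn Set.univ) = (∑ a, f a) / Fintype.card α := by
  rw [integral_fintype (Integrable.of_finite), Finset.sum_div]
  refine Finset.sum_congr rfl fun a _ => ?_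
  have := uniformOn_univ_real {a}
  simp only [Finset.coe_singleton, Finset.card_singleton] at this
  rw [this, smul_eq_mul]
  simp [div_eq_inv_mul]

end

/-! ### Collisions of hash functions -/

section

variable {d s b p J : ℕ} [Fact p.Prime]

/-- The `j + 1` points are independent, and each is one of the at most `d` roots with probability at
most `d / p`. -/
theorem measureReal_polyHash_eq_zero_le {w : Fin d → ZMod p} (hw : w ≠ 0) (j : Fin J) :
    (Measure.pi fun _ : Fin J => uniformOn (Set.univ : Set (ZMod p))).real
      {a | ∀ i ≤ j, polyHash (a i) w = 0} ≤ ((d : ℝ) / p) ^ ((j : ℕ) + 1) := by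
  classical
  set R : Finset (ZMod p) := Finset.univ.filter fun a => polyHash a w = 0 with hR
  have hset : {a : Fin J → ZMod p | ∀ i ≤ j, polyHash (a i) w = 0} =
      Set.univ.pi fun i => if i ≤ j then (R : Set (ZMod p)) else Set.univ := by
    ext a
    simp only [Set.mem_ofPred_eq, Set.mem_pi, Set.mem_univ, true_imp_iff]
    refine forall_congr' fun i => ?_
    split_ifs with hi <;> simp [hi, hR]
  rw [hset, measureReal_def, Measure.pi_pi, ENNReal.toReal_prod]
  have h1 : ∀ i : Fin J, ((uniformOn (Set.univ : Set (ZMod p)))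
      (if i ≤ j then (R : Set (ZMod p)) else Set.univ)).toReal =
      if i ≤ j then (R.card : ℝ) / p else 1 := by
    intro i
    split_ifs
    · rw [← measureReal_def, uniformOn_univ_real, ZMod.card]
    · simp
  rw [Finset.prod_congr rfl fun i _ => h1 i, Finset.prod_ite, Finset.prod_const_one, mul_one,
    Finset.prod_const]
  have h2 : (Finset.univ.filter fun i : Fin J => i ≤ j) = Finset.Iic j := by ext; simp
  rw [h2, Fin.card_Iic]
  gcongr
  exact card_polyHash_eq_zero_le hw

omit [Fact p.Prime] in
-- Such vectors have codes of length at most `b + 4 * b * (j + 1) ≤ 5 * b * (j + 1)`.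
theorem card_sumAbs_leastAbs_le (hs : 0 < s) (hsize : d * (2 * s.size + 1) ≤ b) (j : ℕ)
    (S : Finset (Fin d → ZMod p)) (hS : ∀ w ∈ S, sumAbs (leastAbs w) ≤ s * b * (j + 1)) :
    S.card ≤ 2 ^ (5 * b * (j + 1) + 1) := by
  refine card_le_of_length_le (fun w : Fin d → ZMod p => vecCode (leastAbs w))
    ((vecCode_injective d).comp leastAbs_injective) _ S fun w hw => ?_
  refine (length_vecCode_le hs _).trans ?_
  have h1 : 4 * sumAbs (leastAbs w) / s ≤ 4 * b * (j + 1) := by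
    apply Nat.div_le_of_le_mul
    have := hS w hw
    calc 4 * sumAbs (leastAbs w) ≤ 4 * (s * b * (j + 1)) := by gcongr
      _ = _ := by ring
  nlinarith

/-- Union bound over `j` and the competing vectors. The number of competitors and the survival
probability are both exponential in `j + 1`, which gives terms `2 * x * x ^ j` with `x = 2 ^ (5 * b)
* d / p ≤ 1 / (8 * N)`; their sum is at most `4 * x`. -/
theorem measureReal_collision_le (hs : 0 < s) (hsize : d * (2 * s.size + 1) ≤ b) {N : ℕ}
    (hN : 0 < N) (hp : 8 * N * d * 2 ^ (5 * b) ≤ p) (w : Fin d → ZMod p) :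
    (Measure.pi fun _ : Fin J => uniformOn (Set.univ : Set (ZMod p))).real
      {a | Collision s b w a} ≤ 1 / (2 * N) := by
  classical
  set μ := Measure.pi fun _ : Fin J => uniformOn (Set.univ : Set (ZMod p)) with hμ
  let B : Fin J → Finset (Fin d → ZMod p) := fun j =>
    Finset.univ.filter fun w' => w' ≠ w ∧ sumAbs (leastAbs w') ≤ s * b * (j + 1)
  have hsub : {a | Collision s b w a} ⊆
      ⋃ j ∈ (Finset.univ : Finset (Fin J)), ⋃ w' ∈ B j,
        {a | ∀ i ≤ j, polyHash (a i) (w' - w) = 0} := by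
    rintro a ⟨j, w', h1, h2, h3⟩
    simp only [Set.mem_iUnion]
    exact ⟨j, Finset.mem_univ j, w', by simp [B, h1, h2], h3⟩
  have hp0 : (0 : ℝ) < p := by exact_mod_cast (Fact.out : p.Prime).pos
  have hN0 : (0 : ℝ) < N := by exact_mod_cast hN
  have hN1 : (1 : ℝ) ≤ N := by exact_mod_cast hN
  set x : ℝ := 2 ^ (5 * b) * (d / p) with hx
  have hx0 : 0 ≤ x := by positivity
  have hxN : x ≤ 1 / (8 * N) := by
    rw [hx, ← mul_div_assoc, div_le_div_iff₀ hp0 (by positivity)]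
    have : ((8 * N * d * 2 ^ (5 * b) : ℕ) : ℝ) ≤ p := by exact_mod_cast hp
    push_cast at this
    linarith
  have hx2 : x ≤ 1 / 2 := hxN.trans (by
    rw [div_le_div_iff₀ (by positivity) (by positivity)]; linarith)
  have hterm : ∀ j : Fin J, μ.real (⋃ w' ∈ B j, {a | ∀ i ≤ j, polyHash (a i) (w' - w) = 0}) ≤
      2 * x * (1 / 2) ^ (j : ℕ) := by
    intro j
    calc _ ≤ ∑ w' ∈ B j, μ.real {a | ∀ i ≤ j, polyHash (a i) (w' - w) = 0} :=
          measureReal_biUnion_finset_le _ _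
      _ ≤ ∑ w' ∈ B j, ((d : ℝ) / p) ^ ((j : ℕ) + 1) := Finset.sum_le_sum fun w' hw' =>
          measureReal_polyHash_eq_zero_le (sub_ne_zero.2 (Finset.mem_filter.1 hw').2.1) j
      _ = (B j).card * ((d : ℝ) / p) ^ ((j : ℕ) + 1) := by simp
      _ ≤ 2 ^ (5 * b * (j + 1) + 1) * ((d : ℝ) / p) ^ ((j : ℕ) + 1) := by
          gcongr
          exact_mod_cast card_sumAbs_leastAbs_le hs hsize j (B j)
            fun w' hw' => (Finset.mem_filter.1 hw').2.2
      _ = 2 * x * x ^ (j : ℕ) := by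
          rw [hx, pow_succ, pow_mul, mul_pow]; ring
      _ ≤ _ := by gcongr
  calc μ.real {a | Collision s b w a} ≤ _ := measureReal_mono hsub (measure_ne_top μ _)
    _ ≤ ∑ j, μ.real (⋃ w' ∈ B j, {a | ∀ i ≤ j, polyHash (a i) (w' - w) = 0}) :=
        measureReal_biUnion_finset_le _ _
    _ ≤ ∑ j : Fin J, 2 * x * (1 / 2) ^ (j : ℕ) := Finset.sum_le_sum fun j _ => hterm j
    _ = 2 * x * ∑ j ∈ Finset.range J, (1 / 2 : ℝ) ^ j := by
        rw [← Finset.mul_sum, Fin.sum_univ_eq_sum_range fun j => (1 / 2 : ℝ) ^ j]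
    _ ≤ 2 * (1 / (8 * N)) * 2 := by gcongr; exact sum_geometric_two_le J
    _ = 1 / (2 * N) := by field_simp; ring

end

/-! ### Product measures -/

section

variable {α β : Type*} [MeasurableSpace α] [MeasurableSpace β] {μ : Measure α} {ν : Measure β}
  [IsProbabilityMeasure μ] [IsProbabilityMeasure ν]

theorem measureReal_prod_le_of_forall {S : Set (α × β)} (hS : MeasurableSet S) {ε : ℝ}
    (hε : 0 ≤ ε) (h : ∀ x, ν.real (Prod.mk x ⁻¹' S) ≤ ε) : (μ.prod ν).real S ≤ ε := by
  refine ENNReal.toReal_le_of_le_ofReal hε ?_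
  rw [Measure.prod_apply hS]
  calc _ ≤ ∫⁻ _, ENNReal.ofReal ε ∂μ := lintegral_mono fun x => by
        rw [← ENNReal.ofReal_toReal (measure_ne_top ν _)]
        exact ENNReal.ofReal_le_ofReal (h x)
    _ = _ := by simp

theorem integral_prod_eq_of_forall {f : α × β → ℝ} (hf : Integrable f (μ.prod ν)) {c : ℝ}
    (h : ∀ x, ∫ y, f (x, y) ∂ν = c) : ∫ z, f z ∂(μ.prod ν) = c := by
  rw [integral_prod _ hf, integral_congr_ae (ae_of_all _ h)]
  simp

end

/-! ### Unbiased rounding -/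

/-- The randomized rounding of `x` with the help of a uniform random number `t`. -/
noncomputable def randRound (x t : ℝ) : ℤ := ⌊x⌋ + if t ≤ Int.fract x then 1 else 0

theorem abs_randRound_sub_le (x t : ℝ) : |(randRound x t : ℝ) - x| ≤ 1 := by
  have h1 := Int.fract_nonneg x
  have h2 := (Int.fract_lt_one x).le
  have h3 := Int.floor_add_fract x
  rw [abs_le]
  unfold randRound
  split_ifs <;> push_cast <;> constructor <;> linarith

theorem measurable_randRound : Measurable fun z : ℝ × ℝ => randRound z.1 z.2 := by
  unfold randRound
  refine (Int.measurable_floor.comp measurable_fst).add (Measurable.ite ?_ measurable_const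
    measurable_const)
  exact measurableSet_le measurable_snd (measurable_fract.comp measurable_fst)

instance : IsProbabilityMeasure (volume.restrict (Set.Icc (0 : ℝ) 1)) := ⟨by simp⟩

theorem integral_randRound (x : ℝ) :
    ∫ t, (randRound x t : ℝ) ∂(volume.restrict (Set.Icc (0 : ℝ) 1)) = x := by
  have h0 := Int.fract_nonneg x
  have h1 := (Int.fract_lt_one x).le
  have h : ∀ t, (randRound x t : ℝ) = ⌊x⌋ + (Set.Iic (Int.fract x)).indicator (fun _ => 1) t := by
    intro t
    simp only [randRound, Set.indicator, Set.mem_Iic]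
    split_ifs <;> simp
  simp_rw [h]
  rw [integral_add (integrable_const _) ((integrable_const _).indicator measurableSet_Iic),
    integral_indicator measurableSet_Iic, Measure.restrict_restrict measurableSet_Iic]
  have hset : Set.Iic (Int.fract x) ∩ Set.Icc 0 1 = Set.Icc 0 (Int.fract x) := by
    ext t
    simp only [Set.mem_inter_iff, Set.mem_Iic, Set.mem_Icc]
    constructor
    · rintro ⟨h2, h3, -⟩; exact ⟨h3, h2⟩
    · rintro ⟨h2, h3⟩; exact ⟨h3, h2, h3.trans h1⟩
  rw [hset]
  simp [h0, Int.floor_add_fract]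

/-- Exactly `S % n` of the `n` shifts carry the quotient up by one. Hence a uniform element of `Fin
n` suffices to round `S / n` without bias. -/
theorem sum_int_add_ediv {n : ℕ} (hn : 0 < n) (S : ℤ) :
    ∑ t : Fin n, (S + (t : ℕ)) / (n : ℤ) = S := by
  have hn' : (0 : ℤ) < n := by exact_mod_cast hn
  set r := S % n with hr
  have h0 : 0 ≤ r := Int.emod_nonneg _ hn'.ne'
  have h1 : r < n := Int.emod_lt_of_pos _ hn'
  have hS : S = r + n * (S / n) := (Int.emod_add_mul_ediv S n).symm
  have key : ∀ t : Fin n, (S + (t : ℕ)) / (n : ℤ) =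
      S / n + if (n : ℤ) - r ≤ (t : ℕ) then 1 else 0 := by
    intro t
    have ht : ((t : ℕ) : ℤ) < n := by exact_mod_cast t.2
    have h2 : (S + (t : ℕ)) / (n : ℤ) = S / n + (r + (t : ℕ)) / n := by
      conv_lhs => rw [hS, add_right_comm, Int.add_mul_ediv_left _ _ hn'.ne']
      ring
    rw [h2]
    congr 1
    split_ifs with h
    · rw [Int.ediv_eq_iff_of_pos hn']
      constructor <;> omega
    · exact Int.ediv_eq_zero_of_lt (by omega) (by omega)
  rw [Finset.sum_congr rfl fun t _ => key t, Finset.sum_add_distrib]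
  have hcard : ∑ t : Fin n, (if (n : ℤ) - r ≤ (t : ℕ) then (1 : ℤ) else 0) = r := by
    rw [Fin.sum_univ_eq_sum_range (fun t => if (n : ℤ) - r ≤ (t : ℕ) then (1 : ℤ) else 0),
      Finset.sum_boole]
    have : (Finset.range n).filter (fun t : ℕ => (n : ℤ) - r ≤ (t : ℕ)) =
        Finset.Ico (n - r.toNat) n := by
      ext t; simp only [Finset.mem_filter, Finset.mem_range, Finset.mem_Ico]; omega
    rw [this, Nat.card_Ico]
    omega
  rw [hcard]
  simp
  linarith

/-! ### Norms -/

/-- `c` is the norm of the all-ones vector: `d`, `√d` or 1. The first bound turns coordinatewise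
rounding errors into a norm, the second a norm into the `ℓ₁` distance that governs code lengths.
That one `c` serves both makes the cost the same for the three norms. -/
theorem PiLp.exists_norm_bounds {p : ℝ≥0∞} [Fact (1 ≤ p)] (hp : p = 1 ∨ p = 2 ∨ p = ⊤) {d : ℕ}
    (hd : 1 ≤ d) : ∃ c : ℝ, 0 < c ∧
      (∀ (e : PiLp p fun _ : Fin d => ℝ) (t : ℝ), 0 ≤ t → (∀ i, |e i| ≤ t) → ‖e‖ ≤ t * c) ∧
      ∀ w : PiLp p fun _ : Fin d => ℝ, ∑ i, |w i| ≤ d / c * ‖w‖ := by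
  have hd' : (0 : ℝ) < d := by exact_mod_cast hd
  rcases hp with rfl | rfl | rfl
  · refine ⟨d, hd', fun e t _ h => ?_, fun w => ?_⟩
    · rw [PiLp.norm_eq_of_L1]
      calc ∑ i, ‖e i‖ ≤ ∑ _i : Fin d, t := Finset.sum_le_sum fun i _ => h i
        _ = t * d := by simp [mul_comm]
    · rw [PiLp.norm_eq_of_L1, div_self hd'.ne', one_mul]
      rfl
  · refine ⟨√d, Real.sqrt_pos.2 hd', fun e t ht h => ?_, fun w => ?_⟩
    · rw [PiLp.norm_eq_of_L2]
      refine Real.sqrt_le_iff.2 ⟨by positivity, ?_⟩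
      calc ∑ i, ‖e i‖ ^ 2 ≤ ∑ _i : Fin d, t ^ 2 :=
            Finset.sum_le_sum fun i _ => pow_le_pow_left₀ (norm_nonneg _) (h i) 2
        _ = (t * √d) ^ 2 := by rw [mul_pow, Real.sq_sqrt hd'.le]; simp [mul_comm]
    · rw [PiLp.norm_eq_of_L2, Real.div_sqrt, ← Real.sqrt_mul hd'.le]
      refine Real.le_sqrt_of_sq_le ?_
      simpa using sq_sum_le_card_mul_sum_sq (s := Finset.univ) (f := fun i => |w i|)
  · refine ⟨1, one_pos, fun e t ht h => ?_, fun w => ?_⟩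
    · rw [PiLp.norm_eq_ciSup, mul_one]
      exact Real.iSup_le h ht
    · calc ∑ i, |w i| ≤ ∑ _i : Fin d, ‖w‖ := Finset.sum_le_sum fun i _ => PiLp.norm_apply_le w i
        _ = _ := by simp

/-! ### Quantization -/

section

variable {p : ℝ≥0∞} {d n m J : ℕ} (δ : ℝ)

/-- The seeds of the machines: the randomness of the quantization, that of the final rounding, and
the hash functions. -/
abbrev MeanSeed (n m J : ℕ) : Type := ℝ × Fin n × (Fin J → ZMod m)

/-- The local data of a machine: its quantized input and the remaining randomness. -/
noncomputable def quantize (y : (PiLp p fun _ : Fin d => ℝ) × MeanSeed n m J) :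
    (Fin d → ℤ) × Fin n × (Fin J → ZMod m) :=
  -- One random number serves all coordinates: unbiasedness is a statement about single coordinates,
  -- and the error bound is deterministic.
  (fun i => randRound (y.1 i / δ) y.2.1, y.2.2)

/-- The point with the coordinates `δ * v i`. -/
noncomputable def scaleVec (p : ℝ≥0∞) (v : Fin d → ℤ) : PiLp p fun _ : Fin d => ℝ :=
  WithLp.toLp p fun i => δ * v i

/-- The estimate of the mean. -/
noncomputable def meanEstimate
    (o : Fin n × (Fin n → PiLp p fun _ : Fin d => ℝ) × (Fin n → MeanSeed n m J)) :
    PiLp p fun _ : Fin d => ℝ :=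
  scaleVec δ p (intMean (fun u => (quantize δ (o.2.1 u, o.2.2 u)).1) (o.2.2 o.1).2.1)

theorem measurable_quantize :
    Measurable (quantize (p := p) (d := d) (n := n) (m := m) (J := J) δ) := by
  unfold quantize
  refine Measurable.prodMk (measurable_pi_lambda _ fun i => ?_) (by fun_prop)
  refine measurable_randRound.comp (f := fun y : (PiLp p fun _ : Fin d => ℝ) × MeanSeed n m J =>
    (y.1 i / δ, y.2.1)) ?_
  fun_prop

theorem measurable_meanEstimate [NeZero m] :
    Measurable (meanEstimate (p := p) (d := d) (n := n) (m := m) (J := J) δ) := by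
  have h1 : Measurable fun o : Fin n × (Fin n → PiLp p fun _ : Fin d => ℝ) ×
      (Fin n → MeanSeed n m J) => (o.1, fun u => quantize δ (o.2.1 u, o.2.2 u)) := by
    refine measurable_fst.prodMk (measurable_pi_lambda _ fun u => ?_)
    refine (measurable_quantize δ).comp (Measurable.prodMk ?_ ?_)
    · exact (measurable_pi_apply u).comp (measurable_fst.comp measurable_snd)
    · exact (measurable_pi_apply u).comp (measurable_snd.comp measurable_snd)
  have h2 : Measurable fun D : Fin n × (Fin n → (Fin d → ℤ) × Fin n × (Fin J → ZMod m)) =>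
      scaleVec δ p (intMean (fun u => (D.2 u).1) (D.2 D.1).2.1) := Measurable.of_discrete
  have h3 : (fun D : Fin n × (Fin n → (Fin d → ℤ) × Fin n × (Fin J → ZMod m)) =>
      scaleVec δ p (intMean (fun u => (D.2 u).1) (D.2 D.1).2.1)) ∘
      (fun o : Fin n × (Fin n → PiLp p fun _ : Fin d => ℝ) × (Fin n → MeanSeed n m J) =>
        (o.1, fun u => quantize δ (o.2.1 u, o.2.2 u))) = meanEstimate δ := by
    funext o
    rfl
  have h4 := h2.comp h1
  rw [h3] at h4
  exact h4

theorem abs_intMean_sub_le (v : Fin n → Fin d → ℤ) (U : Fin n) (i : Fin d) :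
    |(intMean v U i : ℝ) - (∑ u, (v u i : ℝ)) / n| ≤ 1 := by
  have hn : (0 : ℤ) < n := by exact_mod_cast U.pos
  have hn' : (0 : ℝ) < n := by exact_mod_cast U.pos
  have h3 := Int.mul_ediv_add_emod (∑ u, v u i + (U : ℕ)) n
  have h4 := Int.emod_nonneg (∑ u, v u i + (U : ℕ)) hn.ne'
  have h5 := Int.emod_lt_of_pos (∑ u, v u i + (U : ℕ)) hn
  have hU : ((U : ℕ) : ℤ) < n := by exact_mod_cast U.2
  have h6 : |(n : ℤ) * intMean v U i - ∑ u, v u i| ≤ n := by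
    rw [abs_le, intMean]
    constructor <;> omega
  have h7 : |(n : ℝ) * intMean v U i - ∑ u, (v u i : ℝ)| ≤ n := by exact_mod_cast h6
  have h8 : (intMean v U i : ℝ) - (∑ u, (v u i : ℝ)) / n =
      ((n : ℝ) * intMean v U i - ∑ u, (v u i : ℝ)) / n := by field_simp
  rw [h8, abs_div, abs_of_pos hn', div_le_one hn']
  exact h7

variable {δ}

/-- One `δ` for the quantization of the inputs, one for the rounding of the average. -/
theorem abs_meanEstimate_sub_le (hδ : 0 < δ)
    (o : Fin n × (Fin n → PiLp p fun _ : Fin d => ℝ) × (Fin n → MeanSeed n m J)) (i : Fin d) :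
    |(meanEstimate δ o - (n : ℝ)⁻¹ • ∑ u, o.2.1 u) i| ≤ 2 * δ := by
  have hn' : (0 : ℝ) < n := by exact_mod_cast o.1.pos
  set v : Fin n → Fin d → ℤ := fun u => (quantize δ (o.2.1 u, o.2.2 u)).1 with hv
  have h1 := abs_intMean_sub_le v (o.2.2 o.1).2.1 i
  have h2 : |(∑ u, (v u i : ℝ)) / n - (∑ u, o.2.1 u i / δ) / n| ≤ 1 := by
    rw [← sub_div, ← Finset.sum_sub_distrib, abs_div, abs_of_pos hn', div_le_one hn']
    calc |∑ u, ((v u i : ℝ) - o.2.1 u i / δ)| ≤ ∑ u, |(v u i : ℝ) - o.2.1 u i / δ| :=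
          Finset.abs_sum_le_sum_abs _ _
      _ ≤ ∑ _u : Fin n, (1 : ℝ) := Finset.sum_le_sum fun u _ => abs_randRound_sub_le _ _
      _ = n := by simp
  have h3 : (meanEstimate δ o - (n : ℝ)⁻¹ • ∑ u, o.2.1 u) i =
      δ * ((intMean v (o.2.2 o.1).2.1 i - (∑ u, (v u i : ℝ)) / n) +
        ((∑ u, (v u i : ℝ)) / n - (∑ u, o.2.1 u i / δ) / n)) := by
    have : (meanEstimate δ o - (n : ℝ)⁻¹ • ∑ u, o.2.1 u) i =
        δ * intMean v (o.2.2 o.1).2.1 i - (n : ℝ)⁻¹ * ∑ u, o.2.1 u i := by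
      simp [meanEstimate, scaleVec, hv]
    rw [this, ← Finset.sum_div]
    field_simp
    ring
  rw [h3, abs_mul, abs_of_pos hδ]
  have := abs_add_le (intMean v (o.2.2 o.1).2.1 i - (∑ u, (v u i : ℝ)) / n)
    ((∑ u, (v u i : ℝ)) / n - (∑ u, o.2.1 u i / δ) / n)
  nlinarith

theorem sumAbs_quantize_sub_le [Fact (1 ≤ p)] (hδ : 0 < δ) {c : ℝ} (hc : 0 < c)
    (hnorm : ∀ w : PiLp p fun _ : Fin d => ℝ, ∑ i, |w i| ≤ d / c * ‖w‖)
    (y y' : (PiLp p fun _ : Fin d => ℝ) × MeanSeed n m J) :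
    (sumAbs ((quantize δ y).1 - (quantize δ y').1) : ℝ) ≤
      d * (2 + ‖y.1 - y'.1‖ / (δ * c)) := by
  have h1 : ∀ i, (((quantize δ y).1 i - (quantize δ y').1 i).natAbs : ℝ) ≤
      2 + |(y.1 - y'.1) i| / δ := by
    intro i
    have h2 := abs_randRound_sub_le (y.1 i / δ) y.2.1
    have h3 := abs_randRound_sub_le (y'.1 i / δ) y'.2.1
    rw [Nat.cast_natAbs, Int.cast_abs]
    have h4 : ((((quantize δ y).1 i - (quantize δ y').1 i : ℤ)) : ℝ) =
        ((randRound (y.1 i / δ) y.2.1 : ℝ) - y.1 i / δ) -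
        ((randRound (y'.1 i / δ) y'.2.1 : ℝ) - y'.1 i / δ) + (y.1 - y'.1) i / δ := by
      simp only [quantize, Int.cast_sub, PiLp.sub_apply]
      ring
    rw [h4, show |(y.1 - y'.1) i| / δ = |(y.1 - y'.1) i / δ| by rw [abs_div, abs_of_pos hδ]]
    refine (abs_add_le _ _).trans ?_
    have := abs_sub ((randRound (y.1 i / δ) y.2.1 : ℝ) - y.1 i / δ)
      ((randRound (y'.1 i / δ) y'.2.1 : ℝ) - y'.1 i / δ)
    linarith
  calc (sumAbs ((quantize δ y).1 - (quantize δ y').1) : ℝ)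
      = ∑ i, (((quantize δ y).1 i - (quantize δ y').1 i).natAbs : ℝ) := by simp [sumAbs]
    _ ≤ ∑ i, (2 + |(y.1 - y'.1) i| / δ) := Finset.sum_le_sum fun i _ => h1 i
    _ = d * 2 + (∑ i, |(y.1 - y'.1) i|) / δ := by
        rw [Finset.sum_add_distrib, Finset.sum_div]; simp
    _ ≤ d * 2 + (d / c * ‖y.1 - y'.1‖) / δ := by gcongr; exact hnorm _
    _ = _ := by field_simp

end

/-! ### Estimates for random inputs -/

section

variable {p : ℝ≥0∞} {d n m J : ℕ} [NeZero m]

/-- The distribution of a seed. -/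
noncomputable def seedLaw (n m J : ℕ) [NeZero m] : Measure (MeanSeed n m J) :=
  (volume.restrict (Set.Icc (0 : ℝ) 1)).prod ((uniformOn Set.univ).prod
    (Measure.pi fun _ => uniformOn Set.univ))

instance [NeZero n] : IsProbabilityMeasure (seedLaw n m J) := by
  unfold seedLaw; infer_instance

/-- The quantization randomness of all machines is independent of their other randomness. -/
theorem measurePreserving_seeds [NeZero n] : MeasurePreserving
    (MeasurableEquiv.arrowProdEquivProdArrow ℝ (Fin n × (Fin J → ZMod m)) (Fin n))
    (Measure.pi fun _ : Fin n => seedLaw n m J)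
    ((Measure.pi fun _ : Fin n => volume.restrict (Set.Icc (0 : ℝ) 1)).prod
      (Measure.pi fun _ : Fin n => (uniformOn Set.univ).prod
        (Measure.pi fun _ => uniformOn Set.univ))) :=
  measurePreserving_arrowProdEquivProdArrow _ _ _ _ _

variable [NeZero n]

/-- The distribution of leader, inputs and seeds. -/
noncomputable def outcomeLaw (m J : ℕ) [NeZero m]
    (ν : Fin n → Measure (PiLp p fun _ : Fin d => ℝ)) :
    Measure (Fin n × (Fin n → PiLp p fun _ : Fin d => ℝ) × (Fin n → MeanSeed n m J)) :=
  (uniformOn Set.univ).prod ((Measure.pi ν).prod (Measure.pi fun _ => seedLaw n m J))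

variable (ν : Fin n → Measure (PiLp p fun _ : Fin d => ℝ)) [∀ u, IsProbabilityMeasure (ν u)]

instance : IsProbabilityMeasure (outcomeLaw m J ν) := by
  unfold outcomeLaw; infer_instance

theorem measurePreserving_inputs : MeasurePreserving (fun o : Fin n ×
    (Fin n → PiLp p fun _ : Fin d => ℝ) × (Fin n → MeanSeed n m J) => o.2.1)
    (outcomeLaw m J ν) (Measure.pi ν) :=
  measurePreserving_fst.comp measurePreserving_snd

variable {ν}


variable [Fact (1 ≤ p)]

omit [NeZero n] in
theorem measurable_mean :
    Measurable fun x : Fin n → PiLp p fun _ : Fin d => ℝ => (n : ℝ)⁻¹ • ∑ u, x u :=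
  (Finset.measurable_fun_sum _ fun u _ => measurable_pi_apply u).fun_const_smul _

theorem isUnbiased_mean {g : PiLp p fun _ : Fin d => ℝ} (h : ∀ u, IsUnbiased (ν u) id g) :
    IsUnbiased (Measure.pi ν) (fun x => (n : ℝ)⁻¹ • ∑ u, x u) g := by
  have hint : ∀ u, Integrable (fun x : Fin n → PiLp p fun _ : Fin d => ℝ => x u)
      (Measure.pi ν) := fun u =>
    (measurePreserving_eval ν u).integrable_comp_of_integrable (h u).1
  refine ⟨(integrable_finsetSum _ fun u _ => hint u).fun_smul _, ?_⟩
  rw [integral_smul, integral_finsetSum _ fun u _ => hint u]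
  have h1 : ∀ u, ∫ x, x u ∂(Measure.pi ν) = g := fun u => by
    exact (integral_comp_eval (μ := ν) (i := u) (f := id)
      (h u).1.aestronglyMeasurable).trans (h u).2
  simp only [h1, Finset.sum_const, Finset.card_univ, Fintype.card_fin]
  rw [← Nat.cast_smul_eq_nsmul ℝ, smul_smul, inv_mul_cancel₀ (by simp [NeZero.ne n]), one_smul]

omit [Fact (1 ≤ p)] in
theorem integral_rounding {δ : ℝ} (a : ℝ) (S : ℤ) (l : Fin n) :
    ∫ V : Fin n → Fin n × (Fin J → ZMod m), (δ * ((S + ((V l).1 : ℕ)) / n : ℤ) - a)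
      ∂(Measure.pi fun _ : Fin n => (uniformOn (Set.univ : Set (Fin n))).prod
        (Measure.pi fun _ : Fin J => uniformOn (Set.univ : Set (ZMod m)))) =
      δ * (S / n) - a := by
  have hn' : (0 : ℝ) < n := by exact_mod_cast l.pos
  let G : Fin n → ℝ := fun t => δ * ((S + (t : ℕ)) / n : ℤ) - a
  have h2 := integral_comp_eval (μ := fun _ : Fin n => (uniformOn (Set.univ : Set (Fin n))).prod
    (Measure.pi fun _ : Fin J => uniformOn (Set.univ : Set (ZMod m)))) (i := l)
    (f := fun y => G y.1) (Measurable.of_discrete (f := fun y : Fin n × (Fin J → ZMod m) =>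
      G y.1)).aestronglyMeasurable
  refine h2.trans ?_
  rw [integral_fun_fst, integral_uniformOn_univ, Fintype.card_fin]
  have h3 : ∑ t : Fin n, (((S + (t : ℕ)) / n : ℤ) : ℝ) = S := by
    exact_mod_cast sum_int_add_ediv l.pos S
  simp only [G]
  rw [Finset.sum_sub_distrib, ← Finset.mul_sum, h3]
  simp only [probReal_univ, one_smul, Finset.sum_const, Finset.card_univ, Fintype.card_fin,
    nsmul_eq_mul]
  field_simp

omit [NeZero n] in
theorem measurable_randRound_eval (y : ℝ) (u : Fin n) :
    Measurable fun T : Fin n → ℝ => randRound y (T u) :=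
  measurable_randRound.comp (measurable_const.prodMk (measurable_pi_apply u))

omit [NeZero n] in
theorem integrable_randRound_eval (y : ℝ) (u : Fin n) :
    Integrable (fun T : Fin n → ℝ => (randRound y (T u) : ℝ))
      (Measure.pi fun _ : Fin n => volume.restrict (Set.Icc (0 : ℝ) 1)) := by
  have h : Integrable (fun T : Fin n → ℝ => (randRound y (T u) : ℝ) - y)
      (Measure.pi fun _ : Fin n => volume.restrict (Set.Icc (0 : ℝ) 1)) :=
    Integrable.of_bound ((measurable_from_top.comp
      (measurable_randRound_eval y u)).sub_const _).aestronglyMeasurable 1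
      (ae_of_all _ fun T => abs_randRound_sub_le _ _)
  have h' := h.add (integrable_const y)
  refine h'.congr (ae_of_all _ fun T => ?_)
  simp

omit [NeZero n] in
theorem integral_randRound_eval (y : ℝ) (u : Fin n) :
    ∫ T : Fin n → ℝ, (randRound y (T u) : ℝ)
      ∂(Measure.pi fun _ : Fin n => volume.restrict (Set.Icc (0 : ℝ) 1)) = y := by
  have hm : Measurable fun t : ℝ => (randRound y t : ℝ) :=
    measurable_from_top.comp (measurable_randRound.comp (measurable_const.prodMk measurable_id))
  rw [integral_comp_eval (μ := fun _ : Fin n => volume.restrict (Set.Icc (0 : ℝ) 1))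
    (i := u) (f := fun t => (randRound y t : ℝ)) hm.aestronglyMeasurable, integral_randRound]

omit [Fact (1 ≤ p)] in
-- Leader and inputs are fixed. Integrating over the final rounding first replaces the floor by the
-- exact quotient; what remains is affine in the quantized inputs, which have the right means.
theorem integral_seeds_meanEstimate {δ : ℝ} (hδ : 0 < δ) (l : Fin n)
    (x : Fin n → PiLp p fun _ : Fin d => ℝ) (i : Fin d) :
    ∫ s, (meanEstimate δ (l, x, s) - (n : ℝ)⁻¹ • ∑ u, x u) i
      ∂(Measure.pi fun _ : Fin n => seedLaw n m J) = 0 := by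
  have hn' : (0 : ℝ) < n := by exact_mod_cast l.pos
  let S : (Fin n → ℝ) → ℤ := fun T => ∑ u, randRound (x u i / δ) (T u)
  let H : ℤ × Fin n → ℝ := fun y => δ * ((y.1 + (y.2 : ℕ)) / n : ℤ) - (n : ℝ)⁻¹ * ∑ u, x u i
  let F : (Fin n → ℝ) × (Fin n → Fin n × (Fin J → ZMod m)) → ℝ := fun z =>
    H (S z.1, (z.2 l).1)
  have hF : ∀ s : Fin n → MeanSeed n m J,
      (meanEstimate δ (l, x, s) - (n : ℝ)⁻¹ • ∑ u, x u) i =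
        F (MeasurableEquiv.arrowProdEquivProdArrow ℝ (Fin n × (Fin J → ZMod m)) (Fin n) s) := by
    intro s
    simp [F, H, S, meanEstimate, scaleVec, intMean, quantize,
      MeasurableEquiv.arrowProdEquivProdArrow, Equiv.arrowProdEquivProdArrow]
  have hS : Measurable S := Finset.measurable_sum _ fun u _ => measurable_randRound_eval _ u
  have hmeasF : Measurable F := by
    have h1 : Measurable fun z : (Fin n → ℝ) × (Fin n → Fin n × (Fin J → ZMod m)) =>
        (S z.1, (z.2 l).1) :=
      (hS.comp measurable_fst).prodMk (by fun_prop)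
    have h2 : Measurable H := Measurable.of_discrete
    exact h2.comp h1
  have hbound : ∀ z, ‖F z‖ ≤ 2 * δ := by
    intro z
    have := abs_meanEstimate_sub_le hδ (l, x, (MeasurableEquiv.arrowProdEquivProdArrow ℝ
      (Fin n × (Fin J → ZMod m)) (Fin n)).symm z) i
    rw [hF, MeasurableEquiv.apply_symm_apply] at this
    exact this
  simp_rw [hF]
  rw [measurePreserving_seeds.integral_comp (MeasurableEquiv.measurableEmbedding _) F,
    integral_prod _ (Integrable.of_bound hmeasF.aestronglyMeasurable (2 * δ) (ae_of_all _ hbound))]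
  simp only [F, H, integral_rounding]
  have hint : Integrable (fun T : Fin n → ℝ => ∑ u, (randRound (x u i / δ) (T u) : ℝ))
      (Measure.pi fun _ : Fin n => volume.restrict (Set.Icc (0 : ℝ) 1)) :=
    integrable_finsetSum _ fun u _ => integrable_randRound_eval _ u
  simp only [S, Int.cast_sum]
  rw [integral_sub ((hint.div_const _).const_mul _) (integrable_const _), integral_const_mul,
    integral_div, integral_finsetSum _ fun u _ => integrable_randRound_eval _ u]
  simp only [integral_randRound_eval, integral_const, probReal_univ, one_smul]
  rw [← Finset.sum_div]
  field_simp
  ring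

/-- The difference from the empirical mean is bounded, hence integrable, and each of its coordinates
has mean 0 given leader and inputs. -/
theorem isUnbiased_meanEstimate {δ : ℝ} (hδ : 0 < δ) {g : PiLp p fun _ : Fin d => ℝ}
    (h : ∀ u, IsUnbiased (ν u) id g) : IsUnbiased (outcomeLaw m J ν) (meanEstimate δ) g := by
  obtain ⟨hX, hXg⟩ := isUnbiased_mean h
  set X : (Fin n → PiLp p fun _ : Fin d => ℝ) → PiLp p fun _ : Fin d => ℝ :=
    fun x => (n : ℝ)⁻¹ • ∑ u, x u with hXdef
  have hXm : Measurable X := measurable_mean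
  have hX' : Integrable (fun o => X o.2.1) (outcomeLaw m J ν) :=
    (measurePreserving_inputs ν).integrable_comp_of_integrable hX
  have hXg' : ∫ o, X o.2.1 ∂(outcomeLaw m J ν) = g := by
    rw [← hXg, ← (measurePreserving_inputs (m := m) (J := J) ν).map_eq,
      integral_map (measurePreserving_inputs ν).measurable.aemeasurable hXm.aestronglyMeasurable]
  have hdiffm : Measurable fun o : Fin n × (Fin n → PiLp p fun _ : Fin d => ℝ) ×
      (Fin n → MeanSeed n m J) => meanEstimate δ o - X o.2.1 :=
    (measurable_meanEstimate δ).sub (hXm.comp (measurePreserving_inputs ν).measurable)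
  have hcoord : ∀ i, Integrable (fun o => (meanEstimate δ o - X o.2.1) i) (outcomeLaw m J ν) := by
    intro i
    refine Integrable.of_bound (Measurable.aestronglyMeasurable ?_) (2 * δ)
      (ae_of_all _ fun o => abs_meanEstimate_sub_le hδ o i)
    exact (PiLp.proj (𝕜 := ℝ) p (fun _ : Fin d => ℝ) i).measurable.comp hdiffm
  have hdiff : Integrable (fun o => meanEstimate δ o - X o.2.1) (outcomeLaw m J ν) := by
    have : Integrable (fun o => WithLp.ofLp (meanEstimate δ o - X o.2.1)) (outcomeLaw m J ν) :=
      Integrable.of_eval hcoord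
    exact (PiLp.continuousLinearEquiv p ℝ (fun _ : Fin d => ℝ)).symm.toContinuousLinearMap
      |>.integrable_comp this
  have hzero : ∫ o, (meanEstimate δ o - X o.2.1) ∂(outcomeLaw m J ν) = 0 := by
    ext i
    have h1 := (PiLp.proj (𝕜 := ℝ) p (fun _ : Fin d => ℝ) i).integral_comp_comm hdiff
    simp only [PiLp.proj_apply] at h1
    rw [← h1]
    have h2 := hcoord i
    unfold outcomeLaw at h2 ⊢
    refine integral_prod_eq_of_forall h2 fun l => ?_
    have h3 : Integrable (fun y : (Fin n → PiLp p fun _ : Fin d => ℝ) × (Fin n → MeanSeed n m J) =>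
        (meanEstimate δ (l, y) - X y.1) i)
        ((Measure.pi ν).prod (Measure.pi fun _ => seedLaw n m J)) := by
      refine Integrable.of_bound (Measurable.aestronglyMeasurable ?_) (2 * δ)
        (ae_of_all _ fun y => abs_meanEstimate_sub_le hδ (l, y) i)
      exact (PiLp.proj (𝕜 := ℝ) p (fun _ : Fin d => ℝ) i).measurable.comp
        (hdiffm.comp measurable_prodMk_left)
    exact integral_prod_eq_of_forall h3 fun x => integral_seeds_meanEstimate hδ l x i
  have hsum : (meanEstimate δ : Fin n × (Fin n → PiLp p fun _ : Fin d => ℝ) ×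
      (Fin n → MeanSeed n m J) → _) = fun o => (meanEstimate δ o - X o.2.1) + X o.2.1 := by
    funext o; rw [sub_add_cancel]
  constructor
  · rw [hsum]; exact hdiff.add hX'
  · rw [hsum, integral_add hdiff hX', hzero, hXg', zero_add]

theorem meanSqDist_meanEstimate_le {δ c : ℝ} (hδ : 0 < δ) (hc : 0 < c)
    (hnorm : ∀ (e : PiLp p fun _ : Fin d => ℝ) (t : ℝ), 0 ≤ t → (∀ i, |e i| ≤ t) → ‖e‖ ≤ t * c)
    (g : PiLp p fun _ : Fin d => ℝ) :
    meanSqDist (outcomeLaw m J ν) (meanEstimate δ) g ≤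
      ENNReal.ofReal (8 * (δ * c) ^ 2) +
        2 * meanSqDist (Measure.pi ν) (fun x => (n : ℝ)⁻¹ • ∑ u, x u) g := by
  set X : (Fin n → PiLp p fun _ : Fin d => ℝ) → PiLp p fun _ : Fin d => ℝ :=
    fun x => (n : ℝ)⁻¹ • ∑ u, x u with hXdef
  have hXm : Measurable X := measurable_mean
  have hpt : ∀ o : Fin n × (Fin n → PiLp p fun _ : Fin d => ℝ) × (Fin n → MeanSeed n m J),
      ‖meanEstimate δ o - g‖ₑ ^ 2 ≤
        ENNReal.ofReal (8 * (δ * c) ^ 2) + 2 * ‖X o.2.1 - g‖ₑ ^ 2 := by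
    intro o
    have h1 : ‖meanEstimate δ o - X o.2.1‖ ≤ 2 * δ * c :=
      hnorm _ _ (by positivity) (abs_meanEstimate_sub_le hδ o)
    have h2 : ‖meanEstimate δ o - g‖ ≤ 2 * δ * c + ‖X o.2.1 - g‖ := by
      have := norm_add_le (meanEstimate δ o - X o.2.1) (X o.2.1 - g)
      rw [sub_add_sub_cancel] at this
      linarith
    have h3 : ‖meanEstimate δ o - g‖ ^ 2 ≤ 8 * (δ * c) ^ 2 + 2 * ‖X o.2.1 - g‖ ^ 2 := by
      have h4 := pow_le_pow_left₀ (norm_nonneg _) h2 2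
      nlinarith [sq_nonneg (2 * δ * c - ‖X o.2.1 - g‖)]
    rw [← ofReal_norm, ← ofReal_norm, ← ENNReal.ofReal_pow (norm_nonneg _),
      ← ENNReal.ofReal_pow (norm_nonneg _), ← ENNReal.ofReal_ofNat 2,
      ← ENNReal.ofReal_mul (by norm_num), ← ENNReal.ofReal_add (by positivity) (by positivity)]
    exact ENNReal.ofReal_le_ofReal h3
  calc meanSqDist (outcomeLaw m J ν) (meanEstimate δ) g
      ≤ ∫⁻ o, (ENNReal.ofReal (8 * (δ * c) ^ 2) + 2 * ‖X o.2.1 - g‖ₑ ^ 2) ∂(outcomeLaw m J ν) :=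
        lintegral_mono hpt
    _ = ENNReal.ofReal (8 * (δ * c) ^ 2) +
        2 * ∫⁻ o, ‖X o.2.1 - g‖ₑ ^ 2 ∂(outcomeLaw m J ν) := by
        rw [lintegral_add_left measurable_const, lintegral_const_mul']
        · simp
        · simp
    _ = _ := by
        congr 2
        exact (measurePreserving_inputs ν).lintegral_comp
          (f := fun x => ‖X x - g‖ₑ ^ 2) ((hXm.sub_const g).enorm.pow_const 2)

end

/-! ### The probability of failure -/

section

variable {p : ℝ≥0∞} [Fact (1 ≤ p)] {d n m J : ℕ} [NeZero m] [NeZero n]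
  {ν : Fin n → Measure (PiLp p fun _ : Fin d => ℝ)} [∀ u, IsProbabilityMeasure (ν u)]
  {g : PiLp p fun _ : Fin d => ℝ} {σ : ℝ}

/-- The distance of the input of `u` from `g`, in units of `σ`. -/
noncomputable def relDist (g : PiLp p fun _ : Fin d => ℝ) (σ : ℝ)
    (x : Fin n → PiLp p fun _ : Fin d => ℝ) (u : Fin n) : ℝ := ‖x u - g‖ / σ

omit [NeZero n] in
theorem relDist_nonneg (hσ : 0 < σ) (x : Fin n → PiLp p fun _ : Fin d => ℝ) (u : Fin n) :
    0 ≤ relDist g σ x u := by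
  unfold relDist; positivity

omit [NeZero n] in
theorem measurable_relDist (u : Fin n) :
    Measurable fun x : Fin n → PiLp p fun _ : Fin d => ℝ => ENNReal.ofReal (relDist g σ x u) := by
  have h : Measurable fun y : PiLp p fun _ : Fin d => ℝ => ENNReal.ofReal (‖y - g‖ / σ) :=
    ENNReal.measurable_ofReal.comp (((measurable_id.sub_const g).norm).div_const σ)
  exact h.comp (measurable_pi_apply u)

omit [NeZero n] in
-- From `2 * t ≤ 1 + t ^ 2`. Costs and wraparounds are controlled by this first moment alone.
theorem lintegral_relDist_le (hσ : 0 < σ) {u : Fin n}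
    (h : meanSqDist (ν u) id g ≤ ENNReal.ofReal (σ ^ 2)) :
    ∫⁻ x, ENNReal.ofReal (relDist g σ x u) ∂(Measure.pi ν) ≤ 1 := by
  have hm : Measurable fun y : PiLp p fun _ : Fin d => ℝ => ENNReal.ofReal (‖y - g‖ / σ) :=
    ENNReal.measurable_ofReal.comp (((measurable_id.sub_const g).norm).div_const σ)
  have h1 : ∫⁻ x, ENNReal.ofReal (relDist g σ x u) ∂(Measure.pi ν) =
      ∫⁻ y, ENNReal.ofReal (‖y - g‖ / σ) ∂(ν u) :=
    (measurePreserving_eval ν u).lintegral_comp hm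
  rw [h1]
  have hpt : ∀ y : PiLp p fun _ : Fin d => ℝ, 2 * ENNReal.ofReal (‖y - g‖ / σ) ≤
      1 + ENNReal.ofReal ((σ ^ 2)⁻¹) * ‖y - g‖ₑ ^ 2 := by
    intro y
    rw [← ofReal_norm, ← ENNReal.ofReal_pow (norm_nonneg _),
      ← ENNReal.ofReal_ofNat 2, ← ENNReal.ofReal_mul (by norm_num),
      ← ENNReal.ofReal_mul (by positivity), ← ENNReal.ofReal_one,
      ← ENNReal.ofReal_add (by positivity) (by positivity)]
    refine ENNReal.ofReal_le_ofReal ?_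
    have h2 : (σ ^ 2)⁻¹ * ‖y - g‖ ^ 2 = (‖y - g‖ / σ) ^ 2 := by field_simp
    rw [h2]
    nlinarith [sq_nonneg (‖y - g‖ / σ - 1)]
  have h3 : 2 * ∫⁻ y, ENNReal.ofReal (‖y - g‖ / σ) ∂(ν u) ≤ 2 * 1 := by
    calc 2 * ∫⁻ y, ENNReal.ofReal (‖y - g‖ / σ) ∂(ν u)
        = ∫⁻ y, 2 * ENNReal.ofReal (‖y - g‖ / σ) ∂(ν u) := (lintegral_const_mul _ hm).symm
      _ ≤ ∫⁻ y, (1 + ENNReal.ofReal ((σ ^ 2)⁻¹) * ‖y - g‖ₑ ^ 2) ∂(ν u) := lintegral_mono hpt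
      _ = 1 + ENNReal.ofReal ((σ ^ 2)⁻¹) * meanSqDist (ν u) id g := by
          rw [lintegral_add_left measurable_const, lintegral_const_mul' _ _ ENNReal.ofReal_ne_top]
          simp [meanSqDist]
      _ ≤ 1 + ENNReal.ofReal ((σ ^ 2)⁻¹) * ENNReal.ofReal (σ ^ 2) := by gcongr
      _ = 2 * 1 := by
          rw [← ENNReal.ofReal_mul (by positivity), inv_mul_cancel₀ (by positivity),
            ENNReal.ofReal_one]
          norm_num
  exact (ENNReal.mul_le_mul_iff_right (by norm_num) (by norm_num)).1 h3

omit [NeZero m] [NeZero n] in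
theorem sumAbs_quantize_sub_le_relDist {δ c : ℝ} {s : ℕ} (hδ : 0 < δ) (hc : 0 < c)
    (hs : 0 < s) (hδcs : δ * c * s = σ)
    (hnorm : ∀ w : PiLp p fun _ : Fin d => ℝ, ∑ i, |w i| ≤ d / c * ‖w‖)
    (x : Fin n → PiLp p fun _ : Fin d => ℝ) (r : Fin n → MeanSeed n m J) (l u : Fin n) :
    (sumAbs ((quantize δ (x u, r u)).1 - (quantize δ (x l, r l)).1) : ℝ) ≤
      s * d * (2 + relDist g σ x u + relDist g σ x l) := by
  have h1 := sumAbs_quantize_sub_le hδ hc hnorm (x u, r u) (x l, r l)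
  have hs' : (1 : ℝ) ≤ s := by exact_mod_cast hs
  have h2 : ‖x u - x l‖ / (δ * c) ≤ s * (relDist g σ x u + relDist g σ x l) := by
    have h3 : ‖x u - x l‖ ≤ ‖x u - g‖ + ‖x l - g‖ := by
      rw [← sub_sub_sub_cancel_right _ _ g]; exact norm_sub_le _ _
    rw [div_le_iff₀ (by positivity), relDist, relDist, ← hδcs]
    have : (s : ℝ) * (‖x u - g‖ / (δ * c * s) + ‖x l - g‖ / (δ * c * s)) * (δ * c) =
        ‖x u - g‖ + ‖x l - g‖ := by field_simp
    rw [this]; exact h3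
  calc _ ≤ _ := h1
    _ ≤ d * (s * 2 + s * (relDist g σ x u + relDist g σ x l)) := by
        gcongr
        linarith
    _ = _ := by ring

/-- A difference this large might not be recovered from its residues. Twice its `ℓ₁` norm is at most
`2 * s * d * f` with `∫ f ≤ 4`, so Markov's inequality gives `8 * s * d / m`. -/
theorem measureReal_le_two_mul_sumAbs {δ c : ℝ} {s N : ℕ} (hδ : 0 < δ) (hc : 0 < c) (hσ : 0 < σ)
    (hs : 0 < s) (hδcs : δ * c * s = σ)
    (hnorm : ∀ w : PiLp p fun _ : Fin d => ℝ, ∑ i, |w i| ≤ d / c * ‖w‖)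
    (h : ∀ u, meanSqDist (ν u) id g ≤ ENNReal.ofReal (σ ^ 2)) (hN : 0 < N)
    (hm : 16 * N * d * s ≤ m) (l u : Fin n) :
    ((Measure.pi ν).prod (Measure.pi fun _ => seedLaw n m J)).real
      {y | m ≤ 2 * sumAbs ((quantize δ (y.1 u, y.2 u)).1 - (quantize δ (y.1 l, y.2 l)).1)} ≤
      1 / (2 * N) := by
  have hm0 : (0 : ℝ) < m := by exact_mod_cast NeZero.pos m
  have hN0 : (0 : ℝ) < N := by exact_mod_cast hN
  let f : (Fin n → PiLp p fun _ : Fin d => ℝ) → ℝ≥0∞ := fun x =>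
    2 + ENNReal.ofReal (relDist g σ x u) + ENNReal.ofReal (relDist g σ x l)
  have hf : Measurable f := (measurable_const.add (measurable_relDist u)).add (measurable_relDist l)
  have hfint : ∫⁻ x, f x ∂(Measure.pi ν) ≤ 4 := by
    simp only [f]
    rw [lintegral_add_right _ (measurable_relDist l), lintegral_add_right _ (measurable_relDist u)]
    calc _ ≤ (2 : ℝ≥0∞) + 1 + 1 := by
          gcongr
          · simp
          · exact lintegral_relDist_le hσ (h u)
          · exact lintegral_relDist_le hσ (h l)
      _ = 4 := by norm_num
  set A : ℝ≥0∞ := ENNReal.ofReal (2 * (s * d)) with hA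
  have hsub : {y : (Fin n → PiLp p fun _ : Fin d => ℝ) × (Fin n → MeanSeed n m J) |
      m ≤ 2 * sumAbs ((quantize δ (y.1 u, y.2 u)).1 - (quantize δ (y.1 l, y.2 l)).1)} ⊆
      Prod.fst ⁻¹' {x | (m : ℝ≥0∞) ≤ A * f x} := by
    rintro ⟨x, r⟩ hy
    have h1 : ((m : ℕ) : ℝ) ≤
        2 * sumAbs ((quantize δ (x u, r u)).1 - (quantize δ (x l, r l)).1) := by exact_mod_cast hy
    have h2 := sumAbs_quantize_sub_le_relDist (g := g) hδ hc hs hδcs hnorm x r l u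
    have h3 : (m : ℝ) ≤ 2 * (s * d) * (2 + relDist g σ x u + relDist g σ x l) := by linarith
    have hu := relDist_nonneg (g := g) hσ x u
    have hl := relDist_nonneg (g := g) hσ x l
    change (m : ℝ≥0∞) ≤ A * f x
    simp only [f, hA]
    rw [← ENNReal.ofReal_natCast m, ← ENNReal.ofReal_ofNat 2,
      ← ENNReal.ofReal_add (by norm_num) hu, ← ENNReal.ofReal_add (by positivity) hl,
      ← ENNReal.ofReal_mul (by positivity)]
    exact ENNReal.ofReal_le_ofReal h3
  have hmarkov : (Measure.pi ν) {x | (m : ℝ≥0∞) ≤ A * f x} ≤ ENNReal.ofReal (1 / (2 * N)) := by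
    have h1 := mul_meas_ge_le_lintegral (μ := Measure.pi ν) (hf.const_mul A) (m : ℝ≥0∞)
    have h2 : ∫⁻ x, A * f x ∂(Measure.pi ν) ≤ A * 4 := by
      rw [lintegral_const_mul _ hf]; gcongr
    have h3 : A * 4 ≤ m * ENNReal.ofReal (1 / (2 * N)) := by
      rw [hA, ← ENNReal.ofReal_ofNat 4, ← ENNReal.ofReal_mul (by positivity),
        ← ENNReal.ofReal_natCast m, ← ENNReal.ofReal_mul (by positivity)]
      refine ENNReal.ofReal_le_ofReal ?_
      rw [mul_one_div, le_div_iff₀ (by positivity)]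
      have : ((16 * N * d * s : ℕ) : ℝ) ≤ m := by exact_mod_cast hm
      push_cast at this
      linarith
    refine (ENNReal.mul_le_mul_iff_right (a := (m : ℝ≥0∞)) ?_ ?_).1 (h1.trans (h2.trans h3))
    · exact_mod_cast NeZero.ne m
    · exact ENNReal.natCast_ne_top m
  refine ENNReal.toReal_le_of_le_ofReal (by positivity) ?_
  calc _ ≤ ((Measure.pi ν).prod (Measure.pi fun _ => seedLaw n m J))
        (Prod.fst ⁻¹' {x | (m : ℝ≥0∞) ≤ A * f x}) := measure_mono hsub
    _ = (Measure.pi ν) {x | (m : ℝ≥0∞) ≤ A * f x} :=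
        measurePreserving_fst.measure_preimage
          (measurableSet_le measurable_const (hf.const_mul A)).nullMeasurableSet
    _ ≤ _ := hmarkov

/-- The hashed vector depends on the quantization randomness of the machines, which is independent
of the hash functions; conditioned on it, `measureReal_collision_le` applies. -/
theorem measureReal_seeds_collision_le [Fact m.Prime] {s b N : ℕ} (hs : 0 < s)
    (hsize : d * (2 * s.size + 1) ≤ b) (hN : 0 < N) (hm : 8 * N * d * 2 ^ (5 * b) ≤ m)
    (w : (Fin n → ℝ) → Fin d → ZMod m) (hw : Measurable w) (u : Fin n) :
    (Measure.pi fun _ : Fin n => seedLaw n m J).real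
      {r | Collision s b (w fun v => (r v).1) (r u).2.2} ≤ 1 / (2 * N) := by
  let S : Set ((Fin n → ℝ) × (Fin n → Fin n × (Fin J → ZMod m))) :=
    {z | Collision s b (w z.1) (z.2 u).2}
  have hS : MeasurableSet S := by
    have h1 : Measurable fun z : (Fin n → ℝ) × (Fin n → Fin n × (Fin J → ZMod m)) =>
        (w z.1, (z.2 u).2) := (hw.comp measurable_fst).prodMk (by fun_prop)
    exact h1 (MeasurableSet.of_discrete (s := {y : (Fin d → ZMod m) × (Fin J → ZMod m) |
      Collision s b y.1 y.2}))
  have h1 : (Measure.pi fun _ : Fin n => seedLaw n m J).real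
      {r | Collision s b (w fun v => (r v).1) (r u).2.2} =
      ((Measure.pi fun _ : Fin n => volume.restrict (Set.Icc (0 : ℝ) 1)).prod
        (Measure.pi fun _ : Fin n => (uniformOn Set.univ).prod
          (Measure.pi fun _ => uniformOn Set.univ))).real S :=
    congrArg ENNReal.toReal (measurePreserving_seeds.measure_preimage hS.nullMeasurableSet)
  rw [h1]
  refine measureReal_prod_le_of_forall hS (by positivity) fun T => ?_
  refine le_trans (le_of_eq ?_) (measureReal_collision_le (J := J) hs hsize hN hm (w T))
  have h2 : MeasurePreserving (fun V : Fin n → Fin n × (Fin J → ZMod m) => (V u).2)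
      (Measure.pi fun _ : Fin n => (uniformOn Set.univ).prod
        (Measure.pi fun _ => uniformOn Set.univ)) (Measure.pi fun _ => uniformOn Set.univ) :=
    measurePreserving_snd.comp (measurePreserving_eval _ u)
  exact congrArg ENNReal.toReal
    (h2.measure_preimage (MeasurableSet.of_discrete
      (s := {a | Collision s b (w T) a})).nullMeasurableSet)

theorem measureReal_failure_le [Fact m.Prime] {δ c : ℝ} {s b N : ℕ} (hδ : 0 < δ) (hc : 0 < c)
    (hσ : 0 < σ) (hs : 0 < s) (hδcs : δ * c * s = σ)
    (hnorm : ∀ w : PiLp p fun _ : Fin d => ℝ, ∑ i, |w i| ≤ d / c * ‖w‖)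
    (h : ∀ u, meanSqDist (ν u) id g ≤ ENNReal.ofReal (σ ^ 2)) (hN : 0 < N)
    (hsize : d * (2 * s.size + 1) ≤ b) (hm : 8 * N * d * 2 ^ (5 * b) ≤ m)
    (hm' : 16 * N * d * s ≤ m) :
    (outcomeLaw m J ν).real {o | ∃ u,
      Collision s b (residue m ((quantize δ (o.2.1 u, o.2.2 u)).1 -
        (quantize δ (o.2.1 o.1, o.2.2 o.1)).1)) (o.2.2 u).2.2 ∨
      m ≤ 2 * sumAbs ((quantize δ (o.2.1 u, o.2.2 u)).1 -
        (quantize δ (o.2.1 o.1, o.2.2 o.1)).1)} ≤ n / N := by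
  have hdata : Measurable fun o : Fin n × (Fin n → PiLp p fun _ : Fin d => ℝ) ×
      (Fin n → MeanSeed n m J) => (o.1, fun u => quantize δ (o.2.1 u, o.2.2 u)) := by
    refine measurable_fst.prodMk (measurable_pi_lambda _ fun u => ?_)
    refine (measurable_quantize δ).comp (Measurable.prodMk ?_ ?_)
    · exact (measurable_pi_apply u).comp (measurable_fst.comp measurable_snd)
    · exact (measurable_pi_apply u).comp (measurable_snd.comp measurable_snd)
  have hms : ∀ Q : Fin n × (Fin n → (Fin d → ℤ) × Fin n × (Fin J → ZMod m)) → Prop,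
      MeasurableSet {o : Fin n × (Fin n → PiLp p fun _ : Fin d => ℝ) ×
        (Fin n → MeanSeed n m J) | Q (o.1, fun u => quantize δ (o.2.1 u, o.2.2 u))} :=
    fun Q => hdata (MeasurableSet.of_discrete (s := {D | Q D}))
  let A : Fin n → Set (Fin n × (Fin n → PiLp p fun _ : Fin d => ℝ) × (Fin n → MeanSeed n m J)) :=
    fun u => {o | Collision s b (residue m ((quantize δ (o.2.1 u, o.2.2 u)).1 -
        (quantize δ (o.2.1 o.1, o.2.2 o.1)).1)) (o.2.2 u).2.2}
  let B : Fin n → Set (Fin n × (Fin n → PiLp p fun _ : Fin d => ℝ) × (Fin n → MeanSeed n m J)) :=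
    fun u => {o | m ≤ 2 * sumAbs ((quantize δ (o.2.1 u, o.2.2 u)).1 -
        (quantize δ (o.2.1 o.1, o.2.2 o.1)).1)}
  have hAm : ∀ u, MeasurableSet (A u) := fun u =>
    hms fun D => Collision s b (residue m ((D.2 u).1 - (D.2 D.1).1)) (D.2 u).2.2
  have hBm : ∀ u, MeasurableSet (B u) := fun u =>
    hms fun D => m ≤ 2 * sumAbs ((D.2 u).1 - (D.2 D.1).1)
  have hA : ∀ u, (outcomeLaw m J ν).real (A u) ≤ 1 / (2 * N) := by
    intro u
    refine measureReal_prod_le_of_forall (hAm u) (by positivity) fun l => ?_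
    refine measureReal_prod_le_of_forall (measurable_prodMk_left (hAm u)) (by positivity)
      fun x => ?_
    refine measureReal_seeds_collision_le hs hsize hN hm (fun T => residue m
      ((fun i => randRound (x u i / δ) (T u)) - fun i => randRound (x l i / δ) (T l))) ?_ u
    have h1 : Measurable fun T : Fin n → ℝ => ((fun i => randRound (x u i / δ) (T u)) -
        fun i => randRound (x l i / δ) (T l) : Fin d → ℤ) :=
      measurable_pi_lambda _ fun i =>
        (measurable_randRound_eval _ u).sub (measurable_randRound_eval _ l)
    exact (Measurable.of_discrete (f := residue m)).comp h1
  have hB : ∀ u, (outcomeLaw m J ν).real (B u) ≤ 1 / (2 * N) := by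
    intro u
    refine measureReal_prod_le_of_forall (hBm u) (by positivity) fun l => ?_
    exact measureReal_le_two_mul_sumAbs hδ hc hσ hs hδcs hnorm h hN hm' l u
  have hN0 : (0 : ℝ) < N := by exact_mod_cast hN
  calc _ ≤ (outcomeLaw m J ν).real (⋃ u ∈ (Finset.univ : Finset (Fin n)), (A u ∪ B u)) := by
        refine measureReal_mono ?_ (measure_ne_top _ _)
        rintro o ⟨u, hu⟩
        simp only [Set.mem_iUnion]
        exact ⟨u, Finset.mem_univ u, hu⟩
    _ ≤ ∑ u, (outcomeLaw m J ν).real (A u ∪ B u) := measureReal_biUnion_finset_le _ _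
    _ ≤ ∑ _u : Fin n, (1 / (2 * N) + 1 / (2 * N) : ℝ) := Finset.sum_le_sum fun u _ =>
        (measureReal_union_le _ _).trans (add_le_add (hA u) (hB u))
    _ = n / N := by simp; field_simp; ring

end

/-! ### The expected communication -/

section

variable {p : ℝ≥0∞} [Fact (1 ≤ p)] {d n m J : ℕ} [NeZero m] [NeZero n]
  {ν : Fin n → Measure (PiLp p fun _ : Fin d => ℝ)} [∀ u, IsProbabilityMeasure (ν u)]
  {g : PiLp p fun _ : Fin d => ℝ} {σ : ℝ}

/-- A bound for the cost of communication between the leader `l` and machine `u`. -/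
noncomputable def costBound (g : PiLp p fun _ : Fin d => ℝ) (σ : ℝ) (l u : Fin n)
    (x : Fin n → PiLp p fun _ : Fin d => ℝ) : ℝ≥0∞ :=
  -- In units of `b`: 1 for the fixed cost, `2 + relDist u + relDist l` for the distance of `u` from
  -- the leader, and the average of the same expression over all machines.
  5 + ENNReal.ofReal (relDist g σ x u) + 2 * ENNReal.ofReal (relDist g σ x l) +
    (n : ℝ≥0∞)⁻¹ * ∑ w, ENNReal.ofReal (relDist g σ x w)

omit [NeZero n] in
theorem measurable_costBound (l u : Fin n) : Measurable (costBound g σ l u) :=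
  ((measurable_const.add (measurable_relDist u)).add ((measurable_relDist l).const_mul 2)).add
    ((Finset.measurable_fun_sum _ fun w _ => measurable_relDist w).const_mul _)

theorem lintegral_costBound_le (hσ : 0 < σ)
    (h : ∀ u, meanSqDist (ν u) id g ≤ ENNReal.ofReal (σ ^ 2)) (l u : Fin n) :
    ∫⁻ x, costBound g σ l u x ∂(Measure.pi ν) ≤ 9 := by
  have hn0 : (n : ℝ≥0∞) ≠ 0 := by exact_mod_cast NeZero.ne n
  unfold costBound
  rw [lintegral_add_right _
      ((Finset.measurable_fun_sum _ fun w _ => measurable_relDist w).const_mul _),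
    lintegral_add_right _ ((measurable_relDist l).const_mul 2),
    lintegral_add_right _ (measurable_relDist u), lintegral_const_mul _ (measurable_relDist l),
    lintegral_const_mul _ (Finset.measurable_fun_sum _ fun w _ => measurable_relDist w),
    lintegral_finsetSum _ fun w _ => measurable_relDist w]
  calc _ ≤ (5 : ℝ≥0∞) + 1 + 2 * 1 + (n : ℝ≥0∞)⁻¹ * ∑ _w : Fin n, 1 := by
        gcongr with w
        · simp
        · exact lintegral_relDist_le hσ (h u)
        · exact lintegral_relDist_le hσ (h l)
        · exact lintegral_relDist_le hσ (h w)
    _ = 5 + 1 + 2 * 1 + 1 := by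
        simp [ENNReal.inv_mul_cancel hn0 (ENNReal.natCast_ne_top n)]
    _ = 9 := by norm_num

/-- A conversation costs at most `9 * K` in expectation. With probability `1/n` the machine is the
leader and has at most `n` of them, otherwise it has one: `9 + 9 = 18`. -/
theorem lintegral_cost_le (hσ : 0 < σ)
    (h : ∀ u, meanSqDist (ν u) id g ≤ ENNReal.ofReal (σ ^ 2)) {K : ℝ≥0∞} (u : Fin n)
    {B : Fin n × (Fin n → PiLp p fun _ : Fin d => ℝ) × (Fin n → MeanSeed n m J) → ℝ≥0∞}
    (hB : ∀ o, B o ≤ K * if u = o.1 then ∑ w, costBound g σ o.1 w o.2.1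
      else costBound g σ o.1 u o.2.1) :
    ∫⁻ o, B o ∂(outcomeLaw m J ν) ≤ K * 18 := by
  let F : Fin n → (Fin n → PiLp p fun _ : Fin d => ℝ) → ℝ≥0∞ := fun l x =>
    if u = l then ∑ w, costBound g σ l w x else costBound g σ l u x
  have hF : ∀ l, Measurable (F l) := by
    intro l
    by_cases hl : u = l
    · simp only [F, hl, if_true]
      exact Finset.measurable_fun_sum _ fun w _ => measurable_costBound l w
    · simp only [F, hl, if_false]
      exact measurable_costBound l u
  have hF' : Measurable fun o : Fin n × (Fin n → PiLp p fun _ : Fin d => ℝ) ×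
      (Fin n → MeanSeed n m J) => F o.1 o.2.1 :=
    measurable_from_prod_countable_right fun l => (hF l).comp measurable_fst
  have hFint : ∀ l, ∫⁻ x, F l x ∂(Measure.pi ν) ≤ (if u = l then 9 * (n : ℝ≥0∞) else 0) + 9 := by
    intro l
    by_cases hl : u = l
    · simp only [F, hl, if_true]
      rw [lintegral_finsetSum _ fun w _ => measurable_costBound l w]
      calc _ ≤ ∑ _w : Fin n, (9 : ℝ≥0∞) :=
            Finset.sum_le_sum fun w _ => lintegral_costBound_le hσ h l w
        _ = 9 * n := by simp [mul_comm]
        _ ≤ _ := le_self_add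
    · simp only [F, hl, if_false, zero_add]
      exact lintegral_costBound_le hσ h l u
  have hn0 : (n : ℝ≥0∞) ≠ 0 := by exact_mod_cast NeZero.ne n
  calc ∫⁻ o, B o ∂(outcomeLaw m J ν) ≤ ∫⁻ o, K * F o.1 o.2.1 ∂(outcomeLaw m J ν) :=
        lintegral_mono hB
    _ = K * ∫⁻ o, F o.1 o.2.1 ∂(outcomeLaw m J ν) := lintegral_const_mul _ hF'
    _ = K * ((n : ℝ≥0∞)⁻¹ * ∑ l, ∫⁻ x, F l x ∂(Measure.pi ν)) := by
        rw [outcomeLaw, lintegral_prod _ hF'.aemeasurable, lintegral_uniformOn_univ,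
          Fintype.card_fin]
        congr 3 with l
        exact measurePreserving_fst.lintegral_comp (hF l)
    _ ≤ K * ((n : ℝ≥0∞)⁻¹ * ∑ l, ((if u = l then 9 * (n : ℝ≥0∞) else 0) + 9)) := by
        gcongr with l
        exact hFint l
    _ = K * ((n : ℝ≥0∞)⁻¹ * (n * 18)) := by
        rw [Finset.sum_add_distrib, Finset.sum_ite_eq]
        simp only [Finset.mem_univ, if_true, Finset.sum_const, Finset.card_univ, Fintype.card_fin,
          nsmul_eq_mul]
        congr 2
        ring
    _ = K * 18 := by
        rw [← mul_assoc (n : ℝ≥0∞)⁻¹, ENNReal.inv_mul_cancel hn0 (ENNReal.natCast_ne_top n),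
            one_mul]

theorem ofReal_add_add_add_sum {t : Fin n → ℝ} (ht : ∀ w, 0 ≤ t w) (l u : Fin n) :
    5 + ENNReal.ofReal (t u) + 2 * ENNReal.ofReal (t l) +
      (n : ℝ≥0∞)⁻¹ * ∑ w, ENNReal.ofReal (t w) =
    ENNReal.ofReal (5 + t u + 2 * t l + (n : ℝ)⁻¹ * ∑ w, t w) := by
  have hn' : (0 : ℝ) < n := by exact_mod_cast NeZero.pos n
  have hu := ht u
  have hl := ht l
  have hsum : 0 ≤ ∑ w, t w := Finset.sum_nonneg fun w _ => ht w
  rw [ENNReal.ofReal_add (by positivity) (by positivity),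
    ENNReal.ofReal_add (by positivity) (by positivity),
    ENNReal.ofReal_add (by positivity) (by positivity), ENNReal.ofReal_mul (by positivity),
    ENNReal.ofReal_mul (by positivity), ENNReal.ofReal_inv_of_pos hn',
    ENNReal.ofReal_sum_of_nonneg fun w _ => ht w]
  simp

theorem costBound_eq_ofReal (hσ : 0 < σ) (l u : Fin n) (x : Fin n → PiLp p fun _ : Fin d => ℝ) :
    costBound g σ l u x = ENNReal.ofReal (5 + relDist g σ x u + 2 * relDist g σ x l +
      (n : ℝ)⁻¹ * ∑ w, relDist g σ x w) :=
  ofReal_add_add_add_sum (relDist_nonneg hσ x) l u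

omit [NeZero m] in
theorem natCast_le_costBound (hσ : 0 < σ) {δ c : ℝ} {s b N : ℕ} {K : ℝ} (hδ : 0 < δ) (hc : 0 < c)
    (hs : 0 < s) (hδcs : δ * c * s = σ) (hdb : d ≤ b) (hK : 0 ≤ K)
    (hnorm : ∀ w : PiLp p fun _ : Fin d => ℝ, ∑ i, |w i| ≤ d / c * ‖w‖)
    (x : Fin n → PiLp p fun _ : Fin d => ℝ) (r : Fin n → MeanSeed n m J) (l u : Fin n)
    (hN : (N : ℝ) ≤ K * (b +
      sumAbs ((quantize δ (x u, r u)).1 - (quantize δ (x l, r l)).1) / s +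
      (∑ w, (sumAbs ((quantize δ (x w, r w)).1 - (quantize δ (x l, r l)).1) : ℝ)) / (n * s))) :
    (N : ℝ≥0∞) ≤ ENNReal.ofReal (K * b) * costBound g σ l u x := by
  have hs' : (0 : ℝ) < s := by exact_mod_cast hs
  have hn' : (0 : ℝ) < n := by exact_mod_cast NeZero.pos n
  have hτ := fun w => relDist_nonneg (g := g) hσ x w
  have hS : ∀ w, (sumAbs ((quantize δ (x w, r w)).1 - (quantize δ (x l, r l)).1) : ℝ) ≤
      s * (b * (2 + relDist g σ x w + relDist g σ x l)) := by
    intro w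
    refine (sumAbs_quantize_sub_le_relDist (g := g) hδ hc hs hδcs hnorm x r l w).trans ?_
    rw [mul_assoc]
    have hdb' : (d : ℝ) ≤ b := by exact_mod_cast hdb
    have := hτ w
    have := hτ l
    gcongr
  have h1 : (sumAbs ((quantize δ (x u, r u)).1 - (quantize δ (x l, r l)).1) : ℝ) / s ≤
      b * (2 + relDist g σ x u + relDist g σ x l) := by
    rw [div_le_iff₀' hs']; exact hS u
  have h2 : (∑ w, (sumAbs ((quantize δ (x w, r w)).1 - (quantize δ (x l, r l)).1) : ℝ)) /
      (n * s) ≤ b * (2 + relDist g σ x l + (n : ℝ)⁻¹ * ∑ w, relDist g σ x w) := by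
    rw [div_le_iff₀ (by positivity)]
    calc _ ≤ ∑ w, s * (b * (2 + relDist g σ x w + relDist g σ x l)) :=
          Finset.sum_le_sum fun w _ => hS w
      _ = _ := by
          rw [← Finset.mul_sum, ← Finset.mul_sum, Finset.sum_add_distrib, Finset.sum_add_distrib]
          simp only [Finset.sum_const, Finset.card_univ, Fintype.card_fin, nsmul_eq_mul]
          field_simp
          ring
  have h3 : (N : ℝ) ≤ (K * b) * (5 + relDist g σ x u + 2 * relDist g σ x l +
      (n : ℝ)⁻¹ * ∑ w, relDist g σ x w) := by
    refine hN.trans ?_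
    rw [mul_assoc]
    gcongr
    linarith
  rw [costBound_eq_ofReal hσ, ← ENNReal.ofReal_mul (mul_nonneg hK (Nat.cast_nonneg b)),
    ← ENNReal.ofReal_natCast]
  exact ENNReal.ofReal_le_ofReal h3

end

/-! ### The variance of a mean in Euclidean space -/

theorem meanSqDist_eq_sum_evariance {Ω : Type} [MeasurableSpace Ω] {μ : Measure Ω} {d : ℕ}
    {Z : Ω → PiLp 2 fun _ : Fin d => ℝ} {g : PiLp 2 fun _ : Fin d => ℝ} (hZm : Measurable Z)
    (hZ : IsUnbiased μ Z g) : meanSqDist μ Z g = ∑ i, evariance (fun ω => Z ω i) μ := by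
  have hmean : ∀ i, ∫ ω, Z ω i ∂μ = g i := fun i => by
    have h1 := (PiLp.proj (𝕜 := ℝ) 2 (fun _ : Fin d => ℝ) i).integral_comp_comm hZ.1
    simp only [PiLp.proj_apply] at h1
    rw [h1, hZ.2]
  have hm : ∀ i, Measurable fun ω => Z ω i := fun i =>
    (PiLp.proj (𝕜 := ℝ) 2 (fun _ : Fin d => ℝ) i).measurable.comp hZm
  simp only [evariance, hmean]
  rw [← lintegral_finsetSum _ fun i _ => ((hm i).sub_const _).enorm.pow_const 2]
  refine lintegral_congr fun ω => ?_
  rw [← ofReal_norm, ← ENNReal.ofReal_pow (norm_nonneg _), PiLp.norm_sq_eq_of_L2,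
    ENNReal.ofReal_sum_of_nonneg fun i _ => by positivity]
  refine Finset.sum_congr rfl fun i _ => ?_
  rw [← ofReal_norm, ← ENNReal.ofReal_pow (norm_nonneg _), PiLp.sub_apply]

/-- The squared `ℓ₂` norm splits into coordinates, and in each of them the variances of independent
inputs add. -/
theorem meanSqDist_mean_le {d n : ℕ} [NeZero n]
    {ν : Fin n → Measure (PiLp 2 fun _ : Fin d => ℝ)} [∀ u, IsProbabilityMeasure (ν u)]
    {g : PiLp 2 fun _ : Fin d => ℝ} {σ : ℝ} (h : ∀ u, IsUnbiased (ν u) id g)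
    (hσ : ∀ u, meanSqDist (ν u) id g ≤ ENNReal.ofReal (σ ^ 2)) :
    meanSqDist (Measure.pi ν) (fun x => (n : ℝ)⁻¹ • ∑ u, x u) g ≤ ENNReal.ofReal (σ ^ 2 / n) := by
  have hn' : (0 : ℝ) < n := by exact_mod_cast NeZero.pos n
  obtain ⟨X, hX⟩ : ∃ X : Fin d → (PiLp 2 fun _ : Fin d => ℝ) → ℝ, ∀ i y, X i y = y i :=
    ⟨fun i y => y i, fun _ _ => rfl⟩
  have hm : ∀ i, Measurable (X i) := fun i => by
    rw [show X i = PiLp.proj (𝕜 := ℝ) 2 (fun _ : Fin d => ℝ) i from funext (hX i)]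
    exact (PiLp.proj (𝕜 := ℝ) 2 (fun _ : Fin d => ℝ) i).measurable
  have hsum : ∀ u, meanSqDist (ν u) id g = ∑ i, evariance (X i) (ν u) := fun u => by
    rw [meanSqDist_eq_sum_evariance measurable_id (h u)]
    exact Finset.sum_congr rfl fun i _ => by rw [funext (hX i)]; rfl
  have hL2 : ∀ u i, MemLp (X i) 2 (ν u) := by
    intro u i
    rw [← evariance_lt_top_iff_memLp (hm i).aestronglyMeasurable]
    have h1 : evariance (X i) (ν u) ≤ ∑ i, evariance (X i) (ν u) :=
      Finset.single_le_sum (f := fun i => evariance (X i) (ν u))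
        (fun _ _ => zero_le) (Finset.mem_univ i)
    exact (h1.trans ((hsum u).symm.le.trans (hσ u))).trans_lt ENNReal.ofReal_lt_top
  have hvar : ∀ u, ∑ i, variance (X i) (ν u) ≤ σ ^ 2 := by
    intro u
    have h1 := hσ u
    rw [hsum u, Finset.sum_congr rfl fun i _ => ((hL2 u i).ofReal_variance_eq).symm,
      ← ENNReal.ofReal_sum_of_nonneg fun i _ => variance_nonneg _ _] at h1
    exact (ENNReal.ofReal_le_ofReal_iff (sq_nonneg σ)).1 h1
  have hcoord : ∀ i, MemLp (fun x : Fin n → PiLp 2 fun _ : Fin d => ℝ =>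
      ((n : ℝ)⁻¹ • ∑ u, x u) i) 2 (Measure.pi ν) ∧
      variance (fun x : Fin n → PiLp 2 fun _ : Fin d => ℝ => ((n : ℝ)⁻¹ • ∑ u, x u) i)
        (Measure.pi ν) = ((n : ℝ)⁻¹) ^ 2 * ∑ u, variance (X i) (ν u) := by
    intro i
    have h1 : (fun x : Fin n → PiLp 2 fun _ : Fin d => ℝ => ((n : ℝ)⁻¹ • ∑ u, x u) i) =
        (n : ℝ)⁻¹ • ∑ u, fun x : Fin n → PiLp 2 fun _ : Fin d => ℝ => X i (x u) := by
      funext x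
      simp [hX]
    rw [h1]
    constructor
    · refine MemLp.const_smul ?_ _
      exact memLp_finsetSum' _ fun u _ =>
        (hL2 u i).comp_measurePreserving (measurePreserving_eval ν u)
    · rw [variance_smul]
      congr 1
      exact variance_sum_pi (μ := ν) (X := fun _ => X i) fun u => hL2 u i
  rw [meanSqDist_eq_sum_evariance measurable_mean (isUnbiased_mean h),
    Finset.sum_congr rfl fun i _ => ((hcoord i).1.ofReal_variance_eq).symm,
    ← ENNReal.ofReal_sum_of_nonneg fun i _ => variance_nonneg _ _]
  refine ENNReal.ofReal_le_ofReal ?_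
  rw [Finset.sum_congr rfl fun i _ => (hcoord i).2, ← Finset.mul_sum, Finset.sum_comm]
  calc ((n : ℝ)⁻¹) ^ 2 * ∑ u, ∑ i, variance (X i) (ν u)
      ≤ ((n : ℝ)⁻¹) ^ 2 * ∑ _u : Fin n, σ ^ 2 := by gcongr with u; exact hvar u
    _ = σ ^ 2 / n := by simp; field_simp

/-! ### Inputs without variance -/

/-- The protocol in which nothing is sent and each machine outputs its input. -/
noncomputable def silentProtocol (n : ℕ) (E : Type) [MeasurableSpace E] : Protocol n E where
  Seed := Unit
  seedSpace := inferInstance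
  law := Measure.dirac ()
  isProb := inferInstance
  send _ _ _ _ _ _ := []
  output _ _ x _ _ := x
  measurableSet_send _ _ _ _ _ := MeasurableSet.const _
  measurable_output _ _ _ := measurable_fst

theorem silentProtocol_outbox {n : ℕ} {E : Type} [MeasurableSpace E]
    (o : (silentProtocol n E).Outcome) (c : Config n) (u w : Fin n) :
    (silentProtocol n E).outbox o c u w = [] := by
  simp [Protocol.outbox, silentProtocol]

theorem silentProtocol_bits {n : ℕ} {E : Type} [MeasurableSpace E]
    (o : (silentProtocol n E).Outcome) (u : Fin n) : (silentProtocol n E).bits o u = 0 := by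
  have : ∀ c w, (silentProtocol n E).inbox o c w = [] := fun c w =>
    Protocol.inbox_eq_nil _ fun u => silentProtocol_outbox o c u w
  simp [Protocol.bits, silentProtocol_outbox, this]

theorem silentProtocol_allOutput {n : ℕ} {E : Type} [MeasurableSpace E]
    {o : (silentProtocol n E).Outcome} {y : E} (h : ∀ u, o.2.1 u = y) :
    (silentProtocol n E).AllOutput o y := by
  -- One round is needed because all machines are active at the start.
  refine ⟨1, fun u => ?_, h⟩
  rw [Protocol.run_succ]
  simp [Protocol.step, Protocol.inbox_eq_nil _ fun v => silentProtocol_outbox o _ v u]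

/-! ### The choice of the parameters -/

theorem Nat.size_le_one_add_log {a : ℕ} (ha : 0 < a) : (a.size : ℝ) ≤ 1 + 2 * Real.log a := by
  have h1 : 2 ^ (a.size - 1) ≤ a := Nat.lt_size.1 (by have := Nat.size_pos.2 ha; omega)
  have h2 : ((a.size - 1 : ℕ) : ℝ) * Real.log 2 ≤ Real.log a := by
    rw [← Real.log_pow]
    exact Real.log_le_log (by positivity) (by exact_mod_cast h1)
  have h3 : (a.size : ℝ) ≤ 1 + ((a.size - 1 : ℕ) : ℝ) := by
    have : a.size ≤ 1 + (a.size - 1) := by omega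
    exact_mod_cast this
  have h4 := Real.log_two_gt_d9
  have h5 : (0 : ℝ) ≤ ((a.size - 1 : ℕ) : ℝ) := Nat.cast_nonneg _
  nlinarith

/-- The contribution `9 * d` that does not grow with `q` is absorbed by `d * log q` at the price of
a factor `1 / log q₀`; this is why `q` must stay away from 1. -/
theorem size_parameter_le {q₀ q : ℝ} (hq₀ : 1 < q₀) (hq : q₀ ≤ q) {d n : ℕ} (hn : 1 ≤ n) :
    ((d * (2 * (⌈√q⌉₊).size + 3) + n.size : ℕ) : ℝ) ≤
      (12 / Real.log q₀ + 3) * (d * Real.log q + Real.log n) + 1 := by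
  have hq1 : 1 < q := hq₀.trans_le hq
  have hlog₀ : 0 < Real.log q₀ := Real.log_pos hq₀
  have hlog : Real.log q₀ ≤ Real.log q := Real.log_le_log (by linarith) hq
  have hsq : 1 ≤ √q := Real.one_le_sqrt.2 hq1.le
  have hs0 : 0 < ⌈√q⌉₊ := Nat.ceil_pos.2 (by linarith)
  have hs1 : (⌈√q⌉₊ : ℝ) ≤ 2 * √q := by
    have := (Nat.ceil_lt_add_one (Real.sqrt_nonneg q)).le
    linarith
  have hs2 : Real.log ⌈√q⌉₊ ≤ 1 + Real.log q / 2 := by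
    calc Real.log ⌈√q⌉₊ ≤ Real.log (2 * √q) :=
          Real.log_le_log (by exact_mod_cast hs0) hs1
      _ = Real.log 2 + Real.log q / 2 := by
          rw [Real.log_mul (by norm_num) (by positivity), Real.log_sqrt (by linarith)]
      _ ≤ _ := by linarith [Real.log_two_lt_d9]
  have hs3 := Nat.size_le_one_add_log hs0
  have hn3 := Nat.size_le_one_add_log (show 0 < n by omega)
  have hlogn : 0 ≤ Real.log n := Real.log_natCast_nonneg n
  have hd : (0 : ℝ) ≤ d := Nat.cast_nonneg d
  have h1 : (d : ℝ) ≤ d * Real.log q / Real.log q₀ := by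
    rw [le_div_iff₀ hlog₀]; gcongr
  push_cast
  have h2 : (d : ℝ) * (2 * (⌈√q⌉₊).size + 3) ≤ d * (9 + 2 * Real.log q) :=
    mul_le_mul_of_nonneg_left (by linarith) hd
  have h3 : (12 / Real.log q₀ + 3) * (d * Real.log q + Real.log n) =
      12 * (d * Real.log q / Real.log q₀) + 12 * Real.log n / Real.log q₀ +
        3 * (d * Real.log q) + 3 * Real.log n := by
    field_simp
    ring
  have h4 : 0 ≤ 12 * Real.log n / Real.log q₀ := by positivity
  have h5 : 0 ≤ d * Real.log q := by
    have : 0 ≤ Real.log q := by linarith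
    positivity
  rw [h3]
  nlinarith

/-- The exponent `k + 7` collects `k + 1` for the power of `n`, 1 for `d` and 5 for `2 ^ (5 * b)`.
Bertrand's postulate costs a factor 2, and the last clause says that a pair of residues fits into `2
* (4 + (k + 7) * b)` bits. -/
theorem exists_prime_parameter {d n s b k : ℕ} (hs : 0 < s) (hdb : d ≤ b)
    (hsb : s.size ≤ b) (hnb : n.size ≤ b) : ∃ m : ℕ, m.Prime ∧
      8 * n ^ (k + 1) * d * 2 ^ (5 * b) ≤ m ∧ 16 * n ^ (k + 1) * d * s ≤ m ∧
      m * m ≤ 2 ^ (2 * (4 + (k + 7) * b)) := by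
  obtain ⟨m, hm, hlt, hle⟩ := Nat.exists_prime_lt_and_le_two_mul (2 ^ (3 + (k + 7) * b))
    (by positivity)
  have hn2 : n ^ (k + 1) ≤ 2 ^ (b * (k + 1)) := by
    rw [pow_mul]
    exact Nat.pow_le_pow_left (Nat.size_le.1 hnb).le _
  have hd2 : d ≤ 2 ^ b := hdb.trans Nat.lt_two_pow_self.le
  have hs2 : s ≤ 2 ^ b := (Nat.size_le.1 hsb).le
  have hb : 1 ≤ b := (Nat.size_pos.2 hs).trans_le hsb
  refine ⟨m, hm, le_trans ?_ hlt.le, le_trans ?_ hlt.le, ?_⟩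
  · calc 8 * n ^ (k + 1) * d * 2 ^ (5 * b)
        ≤ 2 ^ 3 * 2 ^ (b * (k + 1)) * 2 ^ b * 2 ^ (5 * b) := by gcongr; norm_num
      _ = 2 ^ (3 + (k + 7) * b) := by rw [← pow_add, ← pow_add, ← pow_add]; congr 1; ring
  · calc 16 * n ^ (k + 1) * d * s ≤ 2 ^ 4 * 2 ^ (b * (k + 1)) * 2 ^ b * 2 ^ b := by
          gcongr; norm_num
      _ = 2 ^ (4 + (k + 3) * b) := by rw [← pow_add, ← pow_add, ← pow_add]; congr 1; ring
      _ ≤ 2 ^ (3 + (k + 7) * b) := Nat.pow_le_pow_right (by norm_num) (by nlinarith)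
  · calc m * m ≤ (2 * 2 ^ (3 + (k + 7) * b)) * (2 * 2 ^ (3 + (k + 7) * b)) :=
          Nat.mul_le_mul hle hle
      _ = 2 ^ (2 * (4 + (k + 7) * b)) := by ring

/-! ### The protocol -/

theorem exists_protocol_of_pos {p : ℝ≥0∞} [Fact (1 ≤ p)] (hp : p = 1 ∨ p = 2 ∨ p = ⊤) {d n : ℕ}
    (hd : 1 ≤ d) (hn : 1 ≤ n) {σ q : ℝ} (hσ : 0 < σ) (hq : 1 < q) (k : ℕ) :
    ∃ (P : Protocol n (PiLp p fun _ : Fin d => ℝ)) (z : P.Outcome → PiLp p fun _ : Fin d => ℝ),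
      Measurable z ∧
      ∀ (g : PiLp p fun _ : Fin d => ℝ) (ν : Fin n → Measure (PiLp p fun _ : Fin d => ℝ))
        [∀ u, IsProbabilityMeasure (ν u)],
        (∀ u, IsUnbiased (ν u) id g) →
        (∀ u, meanSqDist (ν u) id g ≤ ENNReal.ofReal (σ ^ 2)) →
        (∀ u, ∫⁻ o, P.bits o u ∂(P.prob ν) ≤ ENNReal.ofReal
          (18 * (4 * k + 58) * (d * (2 * (⌈√q⌉₊).size + 3) + n.size : ℕ))) ∧
        IsUnbiased (P.prob ν) z g ∧
        meanSqDist (P.prob ν) z g ≤ ENNReal.ofReal (8 * (σ ^ 2 / q)) +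
          2 * meanSqDist (Measure.pi ν) (fun x => (n : ℝ)⁻¹ • ∑ u, x u) g ∧
        1 - 1 / (n : ℝ) ^ k ≤ (P.prob ν).real {o | P.AllOutput o (z o)} := by
  obtain ⟨c, hc, hnorm, hnorm'⟩ := PiLp.exists_norm_bounds hp hd
  set s : ℕ := ⌈√q⌉₊ with hsdef
  have hs : 0 < s := Nat.ceil_pos.2 (Real.sqrt_pos.2 (by linarith))
  have hsq : q ≤ (s : ℝ) ^ 2 := Real.sqrt_le_left (by positivity) |>.1 (Nat.le_ceil _)
  set b : ℕ := d * (2 * s.size + 3) + n.size with hbdef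
  have hsize : d * (2 * s.size + 1) ≤ b := by rw [hbdef]; nlinarith
  have hdb : d ≤ b := by rw [hbdef]; nlinarith
  have hsb : s.size ≤ b := by rw [hbdef]; nlinarith
  have hnb : n.size ≤ b := Nat.le_add_left _ _
  have hb : 0 < b := hd.trans hdb
  obtain ⟨m, hm, hm1, hm2, hm3⟩ := exists_prime_parameter (k := k) hs hdb hsb hnb
  have : Fact m.Prime := ⟨hm⟩
  have : NeZero n := ⟨by omega⟩
  let L : ℕ := 2 * (4 + (k + 7) * b)
  have : NeZero L := ⟨by simp only [L]; omega⟩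
  have hL : L ≤ (2 * k + 22) * b := by simp only [L]; nlinarith
  -- More hash functions than the leader can ever ask for, since least absolute residues have `ℓ₁`
  -- norm at most `d * m`.
  let J : ℕ := d * m + 1
  have : NeZero J := ⟨Nat.succ_ne_zero _⟩
  obtain ⟨enc⟩ : Nonempty (ZMod m × ZMod m ↪ (Fin L → Bool)) :=
    Function.Embedding.nonempty_of_card_le (by simpa [ZMod.card, L] using hm3)
  have hs' : (0 : ℝ) < s := by exact_mod_cast hs
  -- A coordinatewise error `δ` then has norm at most `δ * c = σ / s ≤ σ / √q`.
  let δ : ℝ := σ / (s * c)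
  have hδ : 0 < δ := by positivity
  have hδcs : δ * c * s = σ := by simp only [δ]; field_simp
  let I : Interrogation n (PiLp p fun _ : Fin d => ℝ)
      ((Fin d → ℤ) × Fin n × (Fin J → ZMod m)) (Fin d → ZMod m) :=
    estimation n enc s b (scaleVec δ p)
  refine ⟨I.toProtocol (seedLaw n m J) (quantize δ) (measurable_quantize δ), meanEstimate δ,
    measurable_meanEstimate δ, ?_⟩
  intro g ν _ hg hν
  have hexec := fun o => estimation_execution (hf := measurable_quantize δ) (law := seedLaw n m J)
    enc.injective hs hdb hb hsize hL (Nat.lt_succ_self _) (I := I) rfl o rfl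
  refine ⟨fun u => ?_, isUnbiased_meanEstimate hδ hg, ?_, ?_⟩
  · have hcost := lintegral_cost_le (m := m) (J := J) hσ hν
      (K := ENNReal.ofReal ((2 * (2 * k + 22 : ℕ) + 14) * b)) u
      (B := fun o => (I.toProtocol (seedLaw n m J) (quantize δ) (measurable_quantize δ)).bits o u)
      (fun o => by
        obtain ⟨⟨N, hN1, hN2⟩, -⟩ := hexec o
        have hN3 : ∀ w, w ≠ o.1 → (N w : ℝ≥0∞) ≤
            ENNReal.ofReal ((2 * (2 * k + 22 : ℕ) + 14) * b) * costBound g σ o.1 w o.2.1 :=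
          fun w hw => natCast_le_costBound hσ hδ hc hs hδcs hdb (by positivity) hnorm'
            o.2.1 o.2.2 o.1 w (hN2 w hw)
        rw [hN1]
        split_ifs with hu
        · rw [Nat.cast_sum, Finset.mul_sum]
          refine Finset.sum_le_sum fun w _ => ?_
          split_ifs with hw
          · simp
          · exact hN3 w hw
        · exact hN3 u hu)
    refine hcost.trans (le_of_eq ?_)
    rw [← ENNReal.ofReal_ofNat 18, ← ENNReal.ofReal_mul (by positivity)]
    congr 1
    push_cast
    ring
  · refine (meanSqDist_meanEstimate_le hδ hc hnorm g).trans ?_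
    gcongr
    have : δ * c = σ / s := by simp only [δ]; field_simp
    rw [this, div_pow]
    gcongr
  -- One power of `n` more than the target, for the union bound over the machines.
  · have hfail := measureReal_failure_le (J := J) (N := n ^ (k + 1)) hδ hc hσ hs hδcs hnorm' hν
      (by positivity) hsize hm1 hm2
    have hn0 : (n : ℝ) ≠ 0 := by simp [NeZero.ne n]
    have hquot : (n : ℝ) / ((n ^ (k + 1) : ℕ) : ℝ) = 1 / (n : ℝ) ^ k := by
      push_cast; field_simp; ring
    rw [hquot] at hfail
    change 1 - 1 / (n : ℝ) ^ k ≤ (outcomeLaw m J ν).real _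
    -- Agreement and failure cover all outcomes, so subadditivity suffices and the measurability of
    -- the event of agreement is not needed.
    have hcover : (1 : ℝ) ≤ (outcomeLaw m J ν).real {o | (I.toProtocol (seedLaw n m J) (quantize δ)
        (measurable_quantize δ)).AllOutput o (meanEstimate δ o)} + 1 / (n : ℝ) ^ k := by
      refine le_trans ?_ (add_le_add_right hfail _)
      refine le_trans ?_ (measureReal_union_le _ _)
      refine le_trans (le_of_eq (probReal_univ (μ := outcomeLaw m J ν)).symm)
        (measureReal_mono ?_ (measure_ne_top _ _))
      intro o _
      by_cases ho : ∃ u, Collision s b (residue m ((quantize δ (o.2.1 u, o.2.2 u)).1 -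
          (quantize δ (o.2.1 o.1, o.2.2 o.1)).1)) (o.2.2 u).2.2 ∨
          m ≤ 2 * sumAbs ((quantize δ (o.2.1 u, o.2.2 u)).1 -
          (quantize δ (o.2.1 o.1, o.2.2 o.1)).1)
      · exact Or.inr ho
      · refine Or.inl ((hexec o).2 fun u _ => ?_)
        push Not at ho
        exact ho u
    exact sub_le_iff_le_add.2 hcover

/-- The case `σ = 0`, where the lattice would degenerate: almost surely every input equals `g`, so
each machine already holds the empirical mean. -/
theorem exists_protocol_of_eq_zero {p : ℝ≥0∞} [Fact (1 ≤ p)] (d : ℕ) {n : ℕ} (hn : 1 ≤ n) :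
    ∃ (P : Protocol n (PiLp p fun _ : Fin d => ℝ)) (z : P.Outcome → PiLp p fun _ : Fin d => ℝ),
      Measurable z ∧
      ∀ (g : PiLp p fun _ : Fin d => ℝ) (ν : Fin n → Measure (PiLp p fun _ : Fin d => ℝ))
        [∀ u, IsProbabilityMeasure (ν u)],
        (∀ u, IsUnbiased (ν u) id g) →
        (∀ u, meanSqDist (ν u) id g = 0) →
        (∀ o u, P.bits o u = 0) ∧ IsUnbiased (P.prob ν) z g ∧
        meanSqDist (P.prob ν) z g = 0 ∧ (P.prob ν).real {o | P.AllOutput o (z o)} = 1 := by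
  have : NeZero n := ⟨by omega⟩
  have hn0 : (n : ℝ) ≠ 0 := by simp [NeZero.ne n]
  refine ⟨silentProtocol n _, fun o => (n : ℝ)⁻¹ • ∑ u, o.2.1 u,
    measurable_mean.comp (measurable_fst.comp measurable_snd), fun g ν _ hg hν => ?_⟩
  have : IsProbabilityMeasure ((silentProtocol n (PiLp p fun _ : Fin d => ℝ)).prob ν) := by
    unfold Protocol.prob; infer_instance
  have hpres : MeasurePreserving (fun o : (silentProtocol n (PiLp p fun _ : Fin d => ℝ)).Outcome =>
      o.2.1) ((silentProtocol n (PiLp p fun _ : Fin d => ℝ)).prob ν) (Measure.pi ν) :=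
    measurePreserving_fst.comp measurePreserving_snd
  have hae : ∀ u, ∀ᵐ y ∂(ν u), y = g := by
    intro u
    have h1 : Measurable fun y : PiLp p fun _ : Fin d => ℝ => ‖y - g‖ₑ ^ 2 :=
      (measurable_id.sub_const g).enorm.pow_const 2
    have h2 := (lintegral_eq_zero_iff h1).1 (hν u)
    filter_upwards [h2] with y hy
    simpa [sub_eq_zero] using hy
  have hae' : ∀ᵐ o ∂((silentProtocol n (PiLp p fun _ : Fin d => ℝ)).prob ν), ∀ u, o.2.1 u = g :=
    ae_all_iff.2 fun u =>
      ((measurePreserving_eval ν u).comp hpres).quasiMeasurePreserving.ae (hae u)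
  have hz : ∀ o : (silentProtocol n (PiLp p fun _ : Fin d => ℝ)).Outcome,
      (∀ u, o.2.1 u = g) → (n : ℝ)⁻¹ • ∑ u, o.2.1 u = g := by
    intro o ho
    simp only [ho, Finset.sum_const, Finset.card_univ, Fintype.card_fin]
    rw [← Nat.cast_smul_eq_nsmul ℝ, smul_smul, inv_mul_cancel₀ hn0, one_smul]
  have hzae : (fun o : (silentProtocol n (PiLp p fun _ : Fin d => ℝ)).Outcome =>
      (n : ℝ)⁻¹ • ∑ u, o.2.1 u) =ᵐ[(silentProtocol n (PiLp p fun _ : Fin d => ℝ)).prob ν]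
      fun _ => g := hae'.mono hz
  refine ⟨silentProtocol_bits, ⟨(integrable_const g).congr hzae.symm, ?_⟩, ?_, ?_⟩
  · rw [integral_congr_ae hzae]; simp
  · refine (lintegral_congr_ae ?_).trans lintegral_zero
    filter_upwards [hzae] with o ho
    simp [ho]
  · have huniv : {o : (silentProtocol n (PiLp p fun _ : Fin d => ℝ)).Outcome |
        (silentProtocol n (PiLp p fun _ : Fin d => ℝ)).AllOutput o ((n : ℝ)⁻¹ • ∑ u, o.2.1 u)}
        =ᵐ[(silentProtocol n (PiLp p fun _ : Fin d => ℝ)).prob ν] Set.univ := by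
      refine Filter.eventuallyEq_univ.2 (hae'.mono fun o ho => ?_)
      refine silentProtocol_allOutput fun u => ?_
      rw [hz o ho, ho u]
    rw [measureReal_congr huniv, probReal_univ]

theorem theorem4 (q₀ : ℝ) (hq₀ : 1 < q₀) (k : ℕ) :
    ∃ C : ℝ, 0 < C ∧
      ∀ (p : ℝ≥0∞) [Fact (1 ≤ p)], (p = 1 ∨ p = 2 ∨ p = ⊤) →
      ∀ (d n : ℕ), 1 ≤ d → 1 ≤ n →
      ∀ (σ q : ℝ), 0 ≤ σ → q₀ ≤ q →
      ∃ (P : Protocol n (PiLp p fun _ : Fin d => ℝ))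
        (z : P.Outcome → PiLp p fun _ : Fin d => ℝ),
        Measurable z ∧
        ∀ (g : PiLp p fun _ : Fin d => ℝ) (ν : Fin n → Measure (PiLp p fun _ : Fin d => ℝ))
          [∀ u, IsProbabilityMeasure (ν u)],
          (∀ u, IsUnbiased (ν u) id g) →
          (∀ u, meanSqDist (ν u) id g ≤ ENNReal.ofReal (σ ^ 2)) →
          (∀ u, ∫⁻ o, P.bits o u ∂(P.prob ν) ≤
            ENNReal.ofReal (C * (d * Real.log q + Real.log n))) ∧
          IsUnbiased (P.prob ν) z g ∧
          meanSqDist (P.prob ν) z g ≤ ENNReal.ofReal C *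
            (ENNReal.ofReal (σ ^ 2 / q) +
              meanSqDist (Measure.pi ν) (fun x => (n : ℝ)⁻¹ • ∑ u, x u) g) ∧
          (p = 2 → meanSqDist (P.prob ν) z g ≤
            ENNReal.ofReal (C * (σ ^ 2 / q + σ ^ 2 / n))) ∧
          1 - 1 / (n : ℝ) ^ k ≤ (P.prob ν).real {o | P.AllOutput o (z o)} := by
  have hlog₀ : 0 < Real.log q₀ := Real.log_pos hq₀
  have hC8 : (8 : ℝ) ≤ 18 * (4 * k + 58) * (13 / Real.log q₀ + 3) := by
    have h1 : (0 : ℝ) ≤ 13 / Real.log q₀ := by positivity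
    have h2 : (0 : ℝ) ≤ k := Nat.cast_nonneg k
    nlinarith [mul_nonneg h2 h1]
  -- The cost constant of `exists_protocol_of_pos` times that of `size_parameter_le`, with 13 for 12
  -- to absorb the final summand 1 there; as `C ≥ 8`, it also covers the factors 8 and 2 of the
  -- error bound.
  set C : ℝ := 18 * (4 * k + 58) * (13 / Real.log q₀ + 3) with hC
  refine ⟨C, by linarith, ?_⟩
  intro p _ hp d n hd hn σ q hσ hq
  have hn' : (0 : ℝ) < n := by exact_mod_cast hn
  have hq1 : 1 < q := hq₀.trans_le hq
  rcases hσ.eq_or_lt with rfl | hσ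
  · obtain ⟨P, z, hz, h⟩ := exists_protocol_of_eq_zero (p := p) d hn
    refine ⟨P, z, hz, fun g ν _ hg hν => ?_⟩
    obtain ⟨h1, h2, h3, h4⟩ := h g ν hg fun u => by simpa using hν u
    refine ⟨fun u => by simp [h1], h2, by simp [h3], fun _ => by simp [h3], ?_⟩
    rw [h4]
    have : 0 ≤ 1 / (n : ℝ) ^ k := by positivity
    linarith
  · obtain ⟨P, z, hz, h⟩ := exists_protocol_of_pos hp hd hn hσ hq1 k
    refine ⟨P, z, hz, fun g ν _ hg hν => ?_⟩
    obtain ⟨h1, h2, h3, h4⟩ := h g ν hg hν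
    have hvar : meanSqDist (P.prob ν) z g ≤ ENNReal.ofReal C * (ENNReal.ofReal (σ ^ 2 / q) +
        meanSqDist (Measure.pi ν) (fun x => (n : ℝ)⁻¹ • ∑ u, x u) g) := by
      refine h3.trans ?_
      rw [mul_add, ENNReal.ofReal_mul (by norm_num : (0 : ℝ) ≤ 8)]
      gcongr
      rw [← ENNReal.ofReal_ofNat 2]
      exact ENNReal.ofReal_le_ofReal (by linarith)
    refine ⟨fun u => (h1 u).trans (ENNReal.ofReal_le_ofReal ?_), h2, hvar, ?_, h4⟩
    · have hlog : Real.log q₀ ≤ Real.log q := Real.log_le_log (by linarith) hq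
      have hsz := size_parameter_le hq₀ hq (d := d) hn
      have hd' : (1 : ℝ) ≤ d := by exact_mod_cast hd
      have hlogn : 0 ≤ Real.log n := Real.log_natCast_nonneg n
      have hΛ : Real.log q₀ ≤ d * Real.log q + Real.log n := by nlinarith
      have hone : 1 ≤ 1 / Real.log q₀ * (d * Real.log q + Real.log n) := by
        rw [div_mul_eq_mul_div, one_mul, le_div_iff₀ hlog₀]; linarith
      rw [hC, mul_assoc _ (13 / Real.log q₀ + 3)]
      gcongr
      refine hsz.trans ?_
      have : (13 / Real.log q₀ + 3) * (d * Real.log q + Real.log n) =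
          (12 / Real.log q₀ + 3) * (d * Real.log q + Real.log n) +
            1 / Real.log q₀ * (d * Real.log q + Real.log n) := by ring
      linarith
    · rintro rfl
      have : NeZero n := ⟨by omega⟩
      rw [ENNReal.ofReal_mul (p := C) (by linarith),
        ENNReal.ofReal_add (p := σ ^ 2 / q) (by positivity) (by positivity)]
      exact hvar.trans <| mul_le_mul' le_rfl (add_le_add le_rfl (meanSqDist_mean_le hg hν))
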